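/- Let $d\ge 1$. There is a constant $C=C(d)>0$ such that the following holds for every prime $p$, all integers $n\ge 0$ and $t\ge 1$, and every real $0<\delta\le 1$ with $$t\le \frac{\delta}{30}\,p^{\,n/(20d)} .$$ There is a randomized adaptive algorithm with query access to an unknown function $f:\mathbb F_p^n\to\mathbb F_p$, making in every execution at most $$C\cdot\frac{\log^{3d+3}(2t/\delta)}{\delta}$$ queries (so $O_d\big(\log^{3d+3}(t/\delta)/\delta\big)$ queries when $t/\delta\ge 2$), which is a $t$-online-erasure-resilient tester for degree at most $d$, that is: at the start no value of $f$ is erased; after each query an adversary, who knows $f$, the algorithm, and all queries and answers so far, but not the algorithm's random coins, may erase up to $t$ further entries of the truth table of $f$, and a query to an erased entry is answered by $\perp$; and for every $f$ and every strategy of the adversary, - (completeness) if $\deg f\le d$, then the algorithm accepts with probability $1$; - (soundness) if $f$ is $\delta$-far from degree $d$, i.e. $\min_{g:\deg g\le d}\Pr_{x\in\mathbb F_p^n}[f(x)\ne g(x)]\ge\delta$, then the algorithm rejects with probability at least $2/3$. Here $\deg f$ is the total degree of the unique polynomial with all individual degrees at most $p-1$ that represents $f$. -/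

import Mathlib

/-- A deterministic adaptive query algorithm on inputs `X → A`: either it stops and outputs
accept (`true`) or reject (`false`), or it queries a point and continues according to the answer,
which is a value of `A`, or `none` (the symbol `⊥`) if that value is erased. -/
inductive QueryTree (X A : Type) : Type
  | output (accept : Bool) : QueryTree X A
  | query (x : X) (next : Option A → QueryTree X A) : QueryTree X A

/-- The largest number of queries made along a branch. -/
def QueryTree.depth {X A : Type} [Fintype A] : QueryTree X A → ℕ
  | .output _ => 0
  | .query _ next => 1 + Finset.univ.sup fun a => (next a).depth

/-- A strategy of an adversary that erases at most `t` entries after each query. The strategy may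
depend in any way on the transcript so far, i.e. the queries with the answers given (latest
first). As strategies are quantified after the input function and the tester, they may also depend
on these two, but not on the coins of the tester. A randomized strategy is a mixture of these. -/
structure ErasureAdversary (X A : Type) (t : ℕ) where
  /-- The entries erased right after the given (nonempty) transcript. -/
  erase : List (X × Option A) → Finset X
  card_erase_le : ∀ h, (erase h).card ≤ t

/-- The output of a query algorithm on input `f` against an adversary, where `h` is the transcript
so far and `E` is the set of the entries erased so far. -/
def QueryTree.runFrom {X A : Type} [DecidableEq X] {t : ℕ} (f : X → A)
    (adv : ErasureAdversary X A t) :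
    QueryTree X A → List (X × Option A) → Finset X → Bool
  | .output b, _, _ => b
  | .query x next, h, E =>
      let a : Option A := if x ∈ E then none else some (f x)
      (next a).runFrom f adv ((x, a) :: h) (E ∪ adv.erase ((x, a) :: h))

/-- The output of a query algorithm on input `f` against an adversary; nothing is erased at the
start. -/
def QueryTree.run {X A : Type} [DecidableEq X] {t : ℕ} (f : X → A)
    (adv : ErasureAdversary X A t) (T : QueryTree X A) : Bool :=
  T.runFrom f adv [] ∅

/-- A randomized query algorithm: a probability distribution on deterministic ones. -/
abbrev RandomizedTester (X A : Type) : Type := PMF (QueryTree X A)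

/-- The probability that the tester gives the output `b` on input `f` against an adversary. -/
noncomputable def RandomizedTester.prob {X A : Type} [DecidableEq X] {t : ℕ}
    (R : RandomizedTester X A) (f : X → A) (adv : ErasureAdversary X A t) (b : Bool) : ENNReal :=
  PMF.map (fun T => T.run f adv) R b

/-- The functions `𝔽_p^n → 𝔽_p` of degree at most `d`: those whose polynomial expression with all
individual degrees at most `p - 1` has total degree at most `d`. -/
def reedMuller (n p d : ℕ) : Set ((Fin n → ZMod p) → ZMod p) :=
  {f | ∃ P ∈ MvPolynomial.restrictDegree (Fin n) (ZMod p) (p - 1),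
    P.totalDegree ≤ d ∧ ∀ x, MvPolynomial.eval x P = f x}

/-- The fractional Hamming distance: the fraction of the points where `f` and `g` differ. -/
noncomputable def fracDist {X A : Type} [Fintype X] [DecidableEq A] (f g : X → A) : ℝ :=
  (hammingDist f g : ℝ) / (Fintype.card X : ℝ)

/-- The distance of `f` to degree `d` (an infimum over a finite nonempty set, i.e. a minimum). -/
noncomputable def distToDegree {n p : ℕ} [Fact p.Prime] (d : ℕ)
    (f : (Fin n → ZMod p) → ZMod p) : ℝ :=
  ⨅ g : reedMuller n p d, fracDist f g.1

/-- `R` is a `t`-online-erasure-resilient tester for degree at most `d` with distance parameter `δ`,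
with perfect completeness. -/
def IsOnlineErasureResilientTester {n p : ℕ} [Fact p.Prime] (t d : ℕ) (δ : ℝ)
    (R : RandomizedTester (Fin n → ZMod p) (ZMod p)) : Prop :=
  ∀ (f : (Fin n → ZMod p) → ZMod p) (adv : ErasureAdversary (Fin n → ZMod p) (ZMod p) t),
    (f ∈ reedMuller n p d → R.prob f adv true = 1) ∧
    (δ ≤ distToDegree d f → 2 / 3 ≤ R.prob f adv false)

/-- Every possible execution of `R` makes at most `B` queries. -/
def MakesAtMostQueries {X A : Type} [Fintype A] (R : RandomizedTester X A) (B : ℝ) : Prop :=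
  ∀ T ∈ R.support, (T.depth : ℝ) ≤ B

/-! The tester works in independent rounds. A round draws a random affine map `𝔽_p^k → 𝔽_p^n`, with
`2 ^ k` about `(30 t / δ) ^ (20 d)`, and queries the images of `Q` random points of `𝔽_p^k`, where
`Q` is only polynomial in `k`. The tester rejects when no function of degree at most `d` fits all
answers that are not erased, so completeness is immediate.

For soundness, two events are bounded. The adversary rarely hits a query: given all other coins, the
next point is random in an image that is typically huge, whereas the number of erased entries is at
most `t` times the number of queries (`freq_hit_le`). If nothing is hit, the tester decides on true
values, and each round finds an inconsistency with probability at least `δ / (4 s²)`, where `s = (k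
+ d).choose d + 1` (`le_freq_inconsistent`).

The second bound rests on three facts. With probability one half the `Q` points determine the
functions of degree at most `d + 1` (`half_le_freq_determining`). For such points, consistency with
degree `d` under every affine map forces degree at most `d` (`mem_polyDeg_of_agrees`), and
consistency amounts to linear relations on at most `s` of the points
(`exists_mem_eq_of_sparse_relations`). Finally, a function that rarely violates such an
affine-invariant family of sparse relations is close to one that never does
(`exists_close_of_freq_violatedAt`). -/

/-- The functions `𝔽_p^κ → 𝔽_p` of degree at most one. -/
def affineFunctions (p : ℕ) (κ : Type*) [Fact p.Prime] :
    Submodule (ZMod p) ((κ → ZMod p) → ZMod p) :=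
  Submodule.span (ZMod p) (Set.range fun o : Option κ => fun x => o.elim 1 x)

/-- The functions `𝔽_p^κ → 𝔽_p` of degree at most `m`: the span of the products of `m` affine
functions. -/
def polyDeg (p : ℕ) (κ : Type*) [Fact p.Prime] (m : ℕ) :
    Submodule (ZMod p) ((κ → ZMod p) → ZMod p) :=
  affineFunctions p κ ^ m

/-- The maps whose coordinates are affine functions. -/
def IsAffineMap {p : ℕ} [Fact p.Prime] {ι κ : Type*} (A : (ι → ZMod p) → κ → ZMod p) : Prop :=
  ∀ j, (fun u => A u j) ∈ affineFunctions p ι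

/-! ### Degree and finite differences. -/

section Degree

variable {p : ℕ} [Fact p.Prime] {ι κ : Type*}

lemma one_mem_affineFunctions : (1 : (κ → ZMod p) → ZMod p) ∈ affineFunctions p κ :=
  Submodule.subset_span ⟨none, rfl⟩

lemma const_mem_affineFunctions (a : ZMod p) :
    (fun _ => a : (κ → ZMod p) → ZMod p) ∈ affineFunctions p κ := by
  have := (affineFunctions p κ).smul_mem a one_mem_affineFunctions
  convert this using 1
  ext x
  simp

lemma coord_mem_affineFunctions (i : κ) :
    (fun x => x i : (κ → ZMod p) → ZMod p) ∈ affineFunctions p κ :=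
  Submodule.subset_span ⟨some i, rfl⟩

lemma affineFunctions_induction {P : ((κ → ZMod p) → ZMod p) → Prop}
    (one : P 1) (coord : ∀ i, P fun x => x i) (add : ∀ f g, P f → P g → P (f + g))
    (smul : ∀ (a : ZMod p) f, P f → P (a • f)) {f : (κ → ZMod p) → ZMod p}
    (hf : f ∈ affineFunctions p κ) : P f := by
  refine Submodule.span_induction ?_ ?_ (fun f g _ _ => add f g) (fun a f _ => smul a f) hf
  · rintro _ ⟨_ | i, rfl⟩
    · exact one
    · exact coord i
  · simpa using smul 0 1 one

lemma polyDeg_succ (m : ℕ) : polyDeg p κ (m + 1) = polyDeg p κ m * affineFunctions p κ :=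
  pow_succ _ _

lemma mul_affine_mem_polyDeg {m : ℕ} {f g : (κ → ZMod p) → ZMod p} (hf : f ∈ polyDeg p κ m)
    (hg : g ∈ affineFunctions p κ) : f * g ∈ polyDeg p κ (m + 1) := by
  rw [polyDeg_succ]
  exact Submodule.mul_mem_mul hf hg

lemma mul_mem_polyDeg {m m' : ℕ} {f g : (κ → ZMod p) → ZMod p} (hf : f ∈ polyDeg p κ m)
    (hg : g ∈ polyDeg p κ m') : f * g ∈ polyDeg p κ (m + m') := by
  rw [polyDeg, pow_add]
  exact Submodule.mul_mem_mul hf hg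

lemma polyDeg_mono {m m' : ℕ} (h : m ≤ m') : polyDeg p κ m ≤ polyDeg p κ m' := by
  induction h with
  | refl => exact le_rfl
  | step _ ih =>
    refine ih.trans fun f hf => ?_
    simpa using mul_affine_mem_polyDeg hf one_mem_affineFunctions

lemma mem_polyDeg_zero {f : (κ → ZMod p) → ZMod p} :
    f ∈ polyDeg p κ 0 ↔ ∃ a, f = fun _ => a := by
  rw [polyDeg, pow_zero, Submodule.mem_one]
  exact ⟨fun ⟨a, h⟩ => ⟨a, h ▸ rfl⟩, fun ⟨a, h⟩ => ⟨a, h ▸ rfl⟩⟩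

lemma const_mem_polyDeg (m : ℕ) (a : ZMod p) :
    (fun _ => a : (κ → ZMod p) → ZMod p) ∈ polyDeg p κ m :=
  polyDeg_mono (Nat.zero_le m) (mem_polyDeg_zero.2 ⟨a, rfl⟩)

lemma comp_mem_affineFunctions {A : (ι → ZMod p) → κ → ZMod p} (hA : IsAffineMap A)
    {f : (κ → ZMod p) → ZMod p} (hf : f ∈ affineFunctions p κ) :
    f ∘ A ∈ affineFunctions p ι := by
  refine affineFunctions_induction (P := fun f => f ∘ A ∈ affineFunctions p ι)
    one_mem_affineFunctions hA (fun f g hf hg => add_mem hf hg)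
    (fun a f hf => Submodule.smul_mem _ a hf) hf

lemma comp_mem_polyDeg {A : (ι → ZMod p) → κ → ZMod p} (hA : IsAffineMap A) {m : ℕ}
    {f : (κ → ZMod p) → ZMod p} (hf : f ∈ polyDeg p κ m) : f ∘ A ∈ polyDeg p ι m := by
  induction m generalizing f with
  | zero =>
    obtain ⟨a, rfl⟩ := mem_polyDeg_zero.1 hf
    exact mem_polyDeg_zero.2 ⟨a, rfl⟩
  | succ m ih =>
    rw [polyDeg_succ] at hf
    exact Submodule.mul_induction_on hf
      (fun f hf g hg => mul_affine_mem_polyDeg (ih hf) (comp_mem_affineFunctions hA hg))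
      (fun f g hf hg => add_mem hf hg)

lemma isAffineMap_add (h : κ → ZMod p) : IsAffineMap fun x : κ → ZMod p => x + h := fun j =>
  add_mem (coord_mem_affineFunctions j) (const_mem_affineFunctions (h j))

lemma fwdDiff_eq_const {f : (κ → ZMod p) → ZMod p} (hf : f ∈ affineFunctions p κ)
    (h : κ → ZMod p) : ∃ a, fwdDiff h f = fun _ => a := by
  refine affineFunctions_induction (P := fun f => ∃ a, fwdDiff h f = fun _ => a)
    ⟨0, by ext; simp [fwdDiff]⟩ (fun i => ⟨h i, by ext; simp [fwdDiff]⟩) ?_ ?_ hf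
  · rintro f g ⟨a, ha⟩ ⟨b, hb⟩
    exact ⟨a + b, by rw [fwdDiff_add, ha, hb]; rfl⟩
  · rintro c f ⟨a, ha⟩
    exact ⟨c * a, by rw [fwdDiff_const_smul, ha]; rfl⟩

lemma fwdDiff_mem_polyDeg_zero {f : (κ → ZMod p) → ZMod p} (hf : f ∈ polyDeg p κ 0)
    (h : κ → ZMod p) : fwdDiff h f = 0 := by
  obtain ⟨a, rfl⟩ := mem_polyDeg_zero.1 hf
  ext x
  simp [fwdDiff]

/-- By the Leibniz rule for a product with an affine factor, whose own difference is constant. -/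
lemma fwdDiff_mem_polyDeg {m : ℕ} {f : (κ → ZMod p) → ZMod p} (hf : f ∈ polyDeg p κ (m + 1))
    (h : κ → ZMod p) : fwdDiff h f ∈ polyDeg p κ m := by
  induction m generalizing f with
  | zero =>
    rw [zero_add, polyDeg, pow_one] at hf
    exact mem_polyDeg_zero.2 (fwdDiff_eq_const hf h)
  | succ m ih =>
    rw [polyDeg_succ] at hf
    refine Submodule.mul_induction_on hf (fun f hf g hg => ?_) (fun f g hf hg => ?_)
    · have key : fwdDiff h (f * g) = fwdDiff h f * (g ∘ fun x => x + h) + f * fwdDiff h g := by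
        ext x
        simp only [fwdDiff, Pi.mul_apply, Pi.add_apply, Function.comp]
        ring
      rw [key]
      refine add_mem (mul_affine_mem_polyDeg (ih hf)
        (comp_mem_affineFunctions (isAffineMap_add h) hg)) ?_
      obtain ⟨a, ha⟩ := fwdDiff_eq_const hg h
      rw [ha]
      have := mul_mem_polyDeg hf (const_mem_polyDeg 0 a)
      exact this
    · rw [fwdDiff_add]
      exact add_mem hf hg

lemma eq_const_of_fwdDiff_eq_zero {f : (κ → ZMod p) → ZMod p} (hf : ∀ h, fwdDiff h f = 0) :
    f ∈ polyDeg p κ 0 := by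
  refine mem_polyDeg_zero.2 ⟨f 0, ?_⟩
  ext x
  have := congrFun (hf x) 0
  simp only [fwdDiff, zero_add, Pi.zero_apply] at this
  exact sub_eq_zero.1 this

/-- A nonzero function of degree at most `m` is nonzero on a fraction `2⁻ᵐ` of the points. -/
lemma card_le_two_pow_mul_card_ne_zero [Fintype κ] [DecidableEq κ] {m : ℕ} {f : (κ → ZMod p) → ZMod p}
    (hf : f ∈ polyDeg p κ m) (h0 : f ≠ 0) :
    Fintype.card (κ → ZMod p) ≤ 2 ^ m * (Finset.univ.filter fun x => f x ≠ 0).card := by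
  induction m generalizing f with
  | zero =>
    obtain ⟨a, rfl⟩ := mem_polyDeg_zero.1 hf
    have ha : a ≠ 0 := fun h => h0 (by ext; simp [h])
    simp [ha]
  | succ m ih =>
    by_cases hc : ∀ h, fwdDiff h f = 0
    · have := eq_const_of_fwdDiff_eq_zero hc
      obtain ⟨a, rfl⟩ := mem_polyDeg_zero.1 this
      have ha : a ≠ 0 := fun h => h0 (by ext; simp [h])
      simp only [ne_eq, ha, not_false_eq_true, Finset.filter_true, Finset.card_univ]
      exact Nat.le_mul_of_pos_left _ (by positivity)
    · push Not at hc
      obtain ⟨h, hh⟩ := hc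
      refine (ih (fwdDiff_mem_polyDeg hf h) hh).trans ?_
      rw [pow_succ, mul_assoc]
      refine Nat.mul_le_mul_left _ ?_
      -- A nonzero difference at `x` needs `f x ≠ 0` or `f (x + h) ≠ 0`, so the density drops by a
      -- factor of two at most.
      have hsub : (Finset.univ.filter fun x => fwdDiff h f x ≠ 0) ⊆
          (Finset.univ.filter fun x => f x ≠ 0) ∪
            (Finset.univ.filter fun x => f x ≠ 0).map (Equiv.subRight h).toEmbedding := by
        intro x hx
        simp only [Finset.mem_union, Finset.mem_filter, Finset.mem_univ, true_and,
          Finset.mem_map, Equiv.coe_toEmbedding, Equiv.subRight_apply] at hx ⊢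
        by_contra hcon
        push Not at hcon
        apply hx
        have h2 : f (x + h) = 0 := by
          by_contra hne
          exact hcon.2 (x + h) hne (by simp)
        simp [fwdDiff, hcon.1, h2]
      refine (Finset.card_le_card hsub).trans ((Finset.card_union_le _ _).trans ?_)
      rw [Finset.card_map]
      omega

lemma prod_affine_mem_polyDeg {α : Type*} (s : Finset α) {f : α → (κ → ZMod p) → ZMod p}
    (hf : ∀ a ∈ s, f a ∈ affineFunctions p κ) : ∏ a ∈ s, f a ∈ polyDeg p κ s.card := by
  classical
  induction s using Finset.induction_on with
  | empty => exact mem_polyDeg_zero.2 ⟨1, by ext; simp⟩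
  | insert a s ha ih =>
    rw [Finset.prod_insert ha, Finset.card_insert_of_notMem ha, mul_comm]
    exact mul_affine_mem_polyDeg (ih fun b hb => hf b (Finset.mem_insert_of_mem hb))
      (hf a (Finset.mem_insert_self a s))

/-- Binomial coefficients of a coordinate are polynomials of the expected degree. -/
lemma choose_coord_mem_polyDeg (i : κ) {j : ℕ} (hj : j < p) :
    (fun x : κ → ZMod p => ((x i).val.choose j : ZMod p)) ∈ polyDeg p κ j := by
  have hprod : (∏ l ∈ Finset.range j, fun x : κ → ZMod p => x i - (l : ZMod p)) ∈
      polyDeg p κ j := by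
    have := prod_affine_mem_polyDeg (p := p) (Finset.range j)
      (f := fun l => fun x : κ → ZMod p => x i - (l : ZMod p))
      (fun l _ => sub_mem (coord_mem_affineFunctions i) (const_mem_affineFunctions _))
    rwa [Finset.card_range] at this
  have hfac : ((j.factorial : ℕ) : ZMod p) ≠ 0 := by
    rw [Ne, ZMod.natCast_eq_zero_iff]
    intro h
    exact absurd ((Fact.out : p.Prime).dvd_factorial.1 h) (by omega)
  have := (polyDeg p κ j).smul_mem ((j.factorial : ZMod p)⁻¹) hprod
  convert this using 1
  ext x
  simp only [Pi.smul_apply, Finset.prod_apply, smul_eq_mul]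
  rw [eq_inv_mul_iff_mul_eq₀ hfac]
  have h1 : (j.factorial * (x i).val.choose j : ℕ) = (x i).val.descFactorial j :=
    (Nat.descFactorial_eq_factorial_mul_choose _ _).symm
  rw [← Nat.cast_mul, h1]
  have h2 : ∀ (a : ℕ) (b : ℕ), ((a.descFactorial b : ℕ) : ZMod p) =
      ∏ l ∈ Finset.range b, ((a : ZMod p) - l) := by
    intro a b
    rw [← descPochhammer_eval_eq_descFactorial, descPochhammer_eval_eq_prod_range]
  rw [h2, ZMod.natCast_zmod_val]

/-- The map that replaces the `i`-th coordinate by zero. -/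
def zeroCoord [DecidableEq κ] (i : κ) (x : κ → ZMod p) : κ → ZMod p := Function.update x i 0

lemma isAffineMap_zeroCoord [DecidableEq κ] (i : κ) :
    IsAffineMap (zeroCoord i : (κ → ZMod p) → κ → ZMod p) := by
  intro j
  by_cases h : j = i
  · subst h
    simpa [zeroCoord] using const_mem_affineFunctions (κ := κ) (0 : ZMod p)
  · simpa [zeroCoord, h] using coord_mem_affineFunctions j

lemma fwdDiff_iter_mem_polyDeg {m : ℕ} {f : (κ → ZMod p) → ZMod p}
    {h : κ → ZMod p} (hf : fwdDiff h f ∈ polyDeg p κ m) {j : ℕ} (hj : j ≤ m) :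
    (fwdDiff h)^[j + 1] f ∈ polyDeg p κ (m - j) := by
  induction j with
  | zero => simpa using hf
  | succ j ih =>
    rw [Function.iterate_succ_apply']
    have h1 := ih (by omega)
    rw [show m - j = m - (j + 1) + 1 by omega] at h1
    exact fwdDiff_mem_polyDeg h1 h

lemma fwdDiff_iter_eq_zero {m : ℕ} {f : (κ → ZMod p) → ZMod p}
    {h : κ → ZMod p} (hf : fwdDiff h f ∈ polyDeg p κ m) {j : ℕ} (hj : m < j) :
    (fwdDiff h)^[j + 1] f = 0 := by
  induction j, hj using Nat.le_induction with
  | base =>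
    rw [Function.iterate_succ_apply']
    refine fwdDiff_mem_polyDeg_zero ?_ h
    simpa using fwdDiff_iter_mem_polyDeg hf (le_refl m)
  | succ j _ ih =>
    rw [Function.iterate_succ_apply', ih]
    ext x
    simp [fwdDiff]

/-- Newton's expansion in direction `i`, started where that coordinate is zero. As `(x i).val < p`,
only binomials of index below `p` occur, and these are polynomials. The term of index `j + 1` has
degree at most `(j + 1) + (m - j)`, so no relation between `m` and `p` is needed. -/
lemma sub_comp_zeroCoord_mem_polyDeg [DecidableEq κ] {m : ℕ} {f : (κ → ZMod p) → ZMod p}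
    (hf : ∀ h, fwdDiff h f ∈ polyDeg p κ m) (i : κ) :
    f - f ∘ zeroCoord i ∈ polyDeg p κ (m + 1) := by
  set e : κ → ZMod p := Pi.single i 1 with he
  have hN : f - f ∘ zeroCoord i = ∑ j ∈ Finset.range (p - 1),
      (fun x : κ → ZMod p => ((x i).val.choose (j + 1) : ZMod p)) *
        ((fwdDiff e)^[j + 1] f ∘ zeroCoord i) := by
    ext x
    have hx : x = zeroCoord i x + (x i).val • e := by
      ext l
      by_cases hl : l = i
      · subst hl
        rw [Pi.add_apply, Pi.smul_apply, he, Pi.single_eq_same, nsmul_eq_mul]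
        simp [zeroCoord]
      · simp [zeroCoord, he, hl]
    have h1 := shift_eq_sum_fwdDiff_iter e f (x i).val (zeroCoord i x)
    rw [← hx] at h1
    have hp : 0 < p := (Fact.out : p.Prime).pos
    have hv : (x i).val < p := ZMod.val_lt _
    have h2 : f x = ∑ j ∈ Finset.range (p - 1 + 1),
        ((x i).val.choose j) • (fwdDiff e)^[j] f (zeroCoord i x) := by
      rw [h1]
      refine Finset.sum_subset (by intro a; simp only [Finset.mem_range]; omega) ?_
      intro j _ hj
      rw [Nat.choose_eq_zero_of_lt (by simpa using hj), zero_smul]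
    rw [Finset.sum_range_succ'] at h2
    simp only [Pi.sub_apply, Function.comp_apply, Finset.sum_apply, Pi.mul_apply]
    rw [h2]
    simp
  rw [hN]
  refine Submodule.sum_mem _ fun j hj => ?_
  have hjp : j + 1 < p := by
    rw [Finset.mem_range] at hj
    omega
  by_cases hjm : j ≤ m
  · have h1 := comp_mem_polyDeg (isAffineMap_zeroCoord i) (fwdDiff_iter_mem_polyDeg (hf e) hjm)
    have h2 := mul_mem_polyDeg (choose_coord_mem_polyDeg i hjp) h1
    rwa [show j + 1 + (m - j) = m + 1 by omega] at h2
  · rw [fwdDiff_iter_eq_zero (hf e) (not_le.1 hjm)]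
    convert Submodule.zero_mem _ using 1
    ext x
    simp

/-- A function whose differences all have degree at most `m` has degree at most `m + 1`. -/
lemma mem_polyDeg_of_fwdDiff [Fintype κ] {m : ℕ} {f : (κ → ZMod p) → ZMod p}
    (hf : ∀ h, fwdDiff h f ∈ polyDeg p κ m) : f ∈ polyDeg p κ (m + 1) := by
  classical
  -- The coordinates are set to zero one at a time; each change costs a function of degree at most
  -- `m + 1`, and a constant is left at the end.
  have key : ∀ s : Finset κ,
      f - (f ∘ fun x j => if j ∈ s then 0 else x j) ∈ polyDeg p κ (m + 1) := by
    intro s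
    induction s using Finset.induction_on with
    | empty => convert Submodule.zero_mem _ using 1; ext x; simp
    | insert i s hi ih =>
      set A : (κ → ZMod p) → κ → ZMod p := fun x j => if j ∈ s then 0 else x j with hA
      have hAff : IsAffineMap A := by
        intro j
        by_cases hj : j ∈ s
        · simpa [hA, hj] using const_mem_affineFunctions (κ := κ) (0 : ZMod p)
        · simpa [hA, hj] using coord_mem_affineFunctions j
      have hd : ∀ h, fwdDiff h (f ∘ A) ∈ polyDeg p κ m := by
        intro h
        have : fwdDiff h (f ∘ A) = fwdDiff (A h) f ∘ A := by
          ext x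
          have : A (x + h) = A x + A h := by
            ext j
            by_cases hj : j ∈ s <;> simp [hA, hj]
          simp [fwdDiff, this]
        rw [this]
        exact comp_mem_polyDeg hAff (hf _)
      have h2 := sub_comp_zeroCoord_mem_polyDeg hd i
      have h3 := add_mem ih h2
      convert h3 using 1
      have : (fun (x : κ → ZMod p) j => if j ∈ insert i s then 0 else x j) = A ∘ zeroCoord i := by
        ext x j
        by_cases hj : j = i
        · subst hj
          simp [hA, zeroCoord]
        · simp [hA, zeroCoord, hj]
      rw [this, Function.comp_assoc]
      abel
  have h := key Finset.univ
  have hc : (f ∘ fun x j => if j ∈ (Finset.univ : Finset κ) then 0 else x j) ∈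
      polyDeg p κ (m + 1) := by
    refine polyDeg_mono (Nat.zero_le _) (mem_polyDeg_zero.2 ⟨f 0, ?_⟩)
    ext x
    simp only [Finset.mem_univ, if_true, Function.comp_apply]
    rfl
  simpa using add_mem h hc

end Degree

/-! ### Monomials, dimension, and agreement with the Reed–Muller code. -/

/-- The representative of an exponent below `p` that gives the same power function on `𝔽_p`. -/
def reduceExponent (p a : ℕ) : ℕ := if a = 0 then 0 else (a - 1) % (p - 1) + 1

lemma reduceExponent_le (a : ℕ) : reduceExponent p a ≤ a := by
  unfold reduceExponent
  split_ifs with h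
  · exact Nat.zero_le _
  · have := Nat.mod_le (a - 1) (p - 1)
    omega

section Degree

variable {p : ℕ} [Fact p.Prime] {ι κ : Type*}

/-- The symbol `none` acts as a homogenizing variable equal to one, so multisets of size exactly `m`
give all monomials of degree at most `m`. Counting them bounds the dimension. -/
lemma polyDeg_eq_span (m : ℕ) : polyDeg p κ m = Submodule.span (ZMod p)
    (Set.range fun s : Sym (Option κ) m =>
      ((s : Multiset (Option κ)).map fun o => fun x : κ → ZMod p => o.elim 1 x).prod) := by
  induction m with
  | zero =>
    rw [polyDeg, pow_zero, Submodule.one_eq_span]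
    congr 1
    ext f
    simp only [Set.mem_singleton_iff, Set.mem_range]
    constructor
    · rintro rfl
      exact ⟨Sym.nil, by simp⟩
    · rintro ⟨s, rfl⟩
      rw [Sym.eq_nil_of_card_zero s]
      simp
  | succ m ih =>
    rw [polyDeg_succ, ih, affineFunctions, Submodule.span_mul_span]
    congr 1
    ext f
    simp only [Set.mem_mul, Set.mem_range]
    constructor
    · rintro ⟨_, ⟨s, rfl⟩, _, ⟨o, rfl⟩, rfl⟩
      exact ⟨o ::ₛ s, by rw [Sym.coe_cons, Multiset.map_cons, Multiset.prod_cons, mul_comm]⟩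
    · rintro ⟨s, rfl⟩
      obtain ⟨o, s, rfl⟩ := s.exists_eq_cons_of_succ
      exact ⟨_, ⟨s, rfl⟩, _, ⟨o, rfl⟩, by
        rw [Sym.coe_cons, Multiset.map_cons, Multiset.prod_cons, mul_comm]⟩

lemma finrank_polyDeg_le [Fintype κ] (m : ℕ) :
    Module.finrank (ZMod p) (polyDeg p κ m) ≤ (Fintype.card κ + m).choose m := by
  classical
  rw [polyDeg_eq_span]
  refine (finrank_range_le_card _).trans_eq ?_
  rw [Sym.card_sym_eq_choose, Fintype.card_option]
  congr 1
  omega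

lemma monomial_mem_polyDeg [Fintype κ] (α : κ →₀ ℕ) :
    (fun x : κ → ZMod p => ∏ i, x i ^ α i) ∈ polyDeg p κ (∑ i, α i) := by
  classical
  have key : ∀ s : Finset κ,
      (∏ i ∈ s, fun x : κ → ZMod p => x i ^ α i) ∈ polyDeg p κ (∑ i ∈ s, α i) := by
    intro s
    induction s using Finset.induction_on with
    | empty => exact mem_polyDeg_zero.2 ⟨1, by ext; simp⟩
    | insert i s hi ih =>
      rw [Finset.prod_insert hi, Finset.sum_insert hi]
      refine mul_mem_polyDeg ?_ ih
      exact Submodule.pow_mem_pow _ (coord_mem_affineFunctions i) (α i)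
  convert key Finset.univ using 1
  ext x
  simp

lemma eval_mem_polyDeg [Fintype κ] {m : ℕ} {P : MvPolynomial κ (ZMod p)}
    (hP : P.totalDegree ≤ m) : (fun x => MvPolynomial.eval x P) ∈ polyDeg p κ m := by
  have : (fun x => MvPolynomial.eval x P) = ∑ α ∈ P.support,
      P.coeff α • fun x : κ → ZMod p => ∏ i, x i ^ α i := by
    ext x
    rw [MvPolynomial.eval_eq']
    simp
  rw [this]
  refine Submodule.sum_mem _ fun α hα => Submodule.smul_mem _ _ ?_
  refine polyDeg_mono ?_ (monomial_mem_polyDeg α)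
  have := MvPolynomial.le_totalDegree hα
  rw [Finsupp.sum_fintype _ _ (fun _ => rfl)] at this
  exact this.trans hP

/-- Every function on a finite-dimensional space over `𝔽_p` is a polynomial. -/
lemma exists_mem_polyDeg [Fintype κ] (f : (κ → ZMod p) → ZMod p) : ∃ m, f ∈ polyDeg p κ m := by
  have h := MvPolynomial.map_restrict_dom_evalₗ (ZMod p) κ
  have hf : f ∈ (⊤ : Submodule (ZMod p) ((κ → ZMod p) → ZMod p)) := trivial
  rw [← h] at hf
  obtain ⟨P, _, rfl⟩ := hf
  exact ⟨P.totalDegree, eval_mem_polyDeg le_rfl⟩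

lemma reduceExponent_lt (a : ℕ) : reduceExponent p a ≤ p - 1 := by
  have hp : 1 < p := (Fact.out : p.Prime).one_lt
  unfold reduceExponent
  split_ifs with h
  · exact Nat.zero_le _
  · have := Nat.mod_lt (a - 1) (show 0 < p - 1 by omega)
    omega

lemma pow_reduceExponent (x : ZMod p) (a : ℕ) : x ^ reduceExponent p a = x ^ a := by
  unfold reduceExponent
  split_ifs with h
  · rw [h]
  · by_cases hx : x = 0
    · rw [hx, zero_pow (by omega), zero_pow h]
    · conv_rhs => rw [show a = (a - 1) % (p - 1) + 1 + (p - 1) * ((a - 1) / (p - 1)) by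
        have := Nat.mod_add_div (a - 1) (p - 1)
        omega]
      rw [pow_add _ _ ((p - 1) * _), pow_mul, ZMod.pow_card_sub_one_eq_one hx, one_pow, mul_one]

/-- Reducing exponents by `x ^ p = x` makes individual degrees at most `p - 1` and never raises the
total degree. -/
lemma mem_reedMuller_iff {n d : ℕ} {f : (Fin n → ZMod p) → ZMod p} :
    f ∈ reedMuller n p d ↔ f ∈ polyDeg p (Fin n) d := by
  constructor
  · rintro ⟨P, _, hP, h⟩
    rw [← funext h]
    exact eval_mem_polyDeg hP
  · intro hf
    rw [polyDeg_eq_span] at hf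
    refine Submodule.span_induction ?_ ?_ ?_ ?_ hf
    · rintro _ ⟨s, rfl⟩
      set α : Fin n → ℕ := fun i => reduceExponent p ((s : Multiset (Option (Fin n))).count (some i))
        with hα
      refine ⟨MvPolynomial.monomial (Finsupp.equivFunOnFinite.symm α) 1, ?_, ?_, ?_⟩
      · rw [MvPolynomial.mem_restrictDegree]
        intro β hβ i
        have := MvPolynomial.support_monomial_subset hβ
        rw [Finset.mem_singleton] at this
        subst this
        exact reduceExponent_lt _
      · refine (MvPolynomial.totalDegree_monomial_le _ _).trans ?_
        rw [Finsupp.sum_fintype _ _ (fun _ => rfl)]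
        calc ∑ i, (Finsupp.equivFunOnFinite.symm α) i
            ≤ ∑ i, (s : Multiset (Option (Fin n))).count (some i) :=
              Finset.sum_le_sum fun i _ => reduceExponent_le _
          _ ≤ ∑ o : Option (Fin n), (s : Multiset (Option (Fin n))).count o := by
              rw [Fintype.sum_option]
              exact Nat.le_add_left _ _
          _ = d := by
              rw [Multiset.sum_count_eq_card (fun a _ => Finset.mem_univ a)]
              exact s.2
      · intro x
        rw [MvPolynomial.eval_monomial, one_mul, Finsupp.prod_fintype _ _ (fun _ => pow_zero _)]
        beta_reduce
        rw [Finset.prod_multiset_map_count, Finset.prod_apply]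
        rw [Finset.prod_subset (Finset.subset_univ (s : Multiset (Option (Fin n))).toFinset)
          (fun o _ ho => by
            rw [Multiset.mem_toFinset, ← Multiset.count_eq_zero] at ho
            rw [ho, pow_zero, Pi.one_apply])]
        rw [Fintype.prod_option]
        simp [hα, pow_reduceExponent]
    · exact ⟨0, Submodule.zero_mem _, by simp, by simp⟩
    · rintro f g _ _ ⟨P, hP, hP', hPf⟩ ⟨Q, hQ, hQ', hQg⟩
      exact ⟨P + Q, Submodule.add_mem _ hP hQ,
        (MvPolynomial.totalDegree_add _ _).trans (max_le hP' hQ'), by simp [hPf, hQg]⟩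
    · rintro a f _ ⟨P, hP, hP', hPf⟩
      exact ⟨a • P, Submodule.smul_mem _ a hP,
        (MvPolynomial.totalDegree_smul_le _ _).trans hP', by simp [hPf, MvPolynomial.smul_eval]⟩

end Degree

/-! ### Probabilities over finite uniform spaces. -/

section Freq

variable {Ω Ω' : Type*} [Fintype Ω] [Fintype Ω']

open Classical in
/-- The fraction of the elements of a finite type that satisfy a predicate. -/
noncomputable def freq (P : Ω → Prop) : ℝ :=
  (∑ ω, if P ω then (1 : ℝ) else 0) / Fintype.card Ω

lemma freq_nonneg (P : Ω → Prop) : 0 ≤ freq P := by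
  classical
  unfold freq
  refine div_nonneg (Finset.sum_nonneg fun ω _ => ?_) (Nat.cast_nonneg _)
  split_ifs <;> norm_num

lemma freq_mono {P Q : Ω → Prop} (h : ∀ ω, P ω → Q ω) : freq P ≤ freq Q := by
  classical
  unfold freq
  refine div_le_div_of_nonneg_right (Finset.sum_le_sum fun ω _ => ?_) (Nat.cast_nonneg _)
  by_cases hP : P ω
  · simp [hP, h ω hP]
  · simp only [hP, if_false]
    split_ifs <;> norm_num

lemma freq_or_le (P Q : Ω → Prop) : freq (fun ω => P ω ∨ Q ω) ≤ freq P + freq Q := by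
  classical
  unfold freq
  rw [← add_div, ← Finset.sum_add_distrib]
  refine div_le_div_of_nonneg_right (Finset.sum_le_sum fun ω _ => ?_) (Nat.cast_nonneg _)
  by_cases hP : P ω <;> by_cases hQ : Q ω <;> simp [hP, hQ]

lemma freq_false : freq (fun _ : Ω => False) = 0 := by
  simp [freq]

lemma freq_exists_le {α : Type*} (s : Finset α) (P : α → Ω → Prop) :
    freq (fun ω => ∃ a ∈ s, P a ω) ≤ ∑ a ∈ s, freq (P a) := by
  classical
  induction s using Finset.induction_on with
  | empty => simp [freq_false]
  | insert a s ha ih =>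
    rw [Finset.sum_insert ha]
    refine (freq_mono (Q := fun ω => P a ω ∨ ∃ b ∈ s, P b ω) ?_).trans
      ((freq_or_le _ _).trans (by gcongr))
    rintro ω ⟨b, hb, h⟩
    rcases Finset.mem_insert.1 hb with rfl | hb
    · exact Or.inl h
    · exact Or.inr ⟨b, hb, h⟩

lemma freq_not [Nonempty Ω] (P : Ω → Prop) : freq (fun ω => ¬ P ω) = 1 - freq P := by
  classical
  unfold freq
  have h : (Fintype.card Ω : ℝ) ≠ 0 := by simp
  rw [eq_sub_iff_add_eq, ← add_div, ← Finset.sum_add_distrib, div_eq_one_iff_eq h]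
  rw [Finset.sum_congr rfl (g := fun _ => (1 : ℝ))]
  · simp
  · intro ω _
    by_cases hP : P ω <;> simp [hP]

lemma freq_true [Nonempty Ω] : freq (fun _ : Ω => True) = 1 := by
  simpa [freq_false] using freq_not fun _ : Ω => False

lemma freq_le_one (P : Ω → Prop) : freq P ≤ 1 := by
  rcases isEmpty_or_nonempty Ω with h | h
  · simp [freq]
  · have := freq_not P
    have := freq_nonneg fun ω => ¬ P ω
    linarith

lemma exists_not_of_freq_lt_one [Nonempty Ω] {P : Ω → Prop} (h : freq P < 1) : ∃ ω, ¬ P ω := by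
  by_contra hc
  push Not at hc
  have := freq_not P
  have h2 : freq (fun ω => ¬ P ω) = 0 := by
    rw [← freq_false (Ω := Ω)]
    congr 1
    ext ω
    simp [hc ω]
  linarith

lemma freq_eq_card_div (P : Ω → Prop) [DecidablePred P] :
    freq P = (Finset.univ.filter P).card / Fintype.card Ω := by
  classical
  unfold freq
  congr 1
  rw [Finset.natCast_card_filter]
  refine Finset.sum_congr rfl fun ω _ => ?_
  congr

lemma freq_prod (P : Ω → Ω' → Prop) :
    freq (fun ω : Ω × Ω' => P ω.1 ω.2) = (∑ ω, freq (P ω)) / Fintype.card Ω := by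
  classical
  unfold freq
  rw [Fintype.sum_prod_type, Fintype.card_prod, Nat.cast_mul, ← Finset.sum_div, div_div, mul_comm]

lemma freq_prod_le {P : Ω → Ω' → Prop} {c : ℝ} (hc : 0 ≤ c) (h : ∀ ω, freq (P ω) ≤ c) :
    freq (fun ω : Ω × Ω' => P ω.1 ω.2) ≤ c := by
  rw [freq_prod]
  refine div_le_of_le_mul₀ (Nat.cast_nonneg _) hc ((Finset.sum_le_sum fun ω _ => h ω).trans ?_)
  simp [mul_comm]

lemma exists_freq_le [Nonempty Ω] {P : Ω → Ω' → Prop} {c : ℝ}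
    (h : freq (fun ω : Ω × Ω' => P ω.1 ω.2) ≤ c) : ∃ ω, freq (P ω) ≤ c := by
  rw [freq_prod] at h
  by_contra hc
  push Not at hc
  have hcard : (0 : ℝ) < Fintype.card Ω := by
    exact_mod_cast Fintype.card_pos
  rw [div_le_iff₀ hcard] at h
  have h2 : ∑ _ω : Ω, c < ∑ ω, freq (P ω) :=
    Finset.sum_lt_sum_of_nonempty Finset.univ_nonempty fun ω _ => hc ω
  simp only [Finset.sum_const, Finset.card_univ, nsmul_eq_mul] at h2
  linarith

/-- A Markov inequality: if `P` has frequency at least `c` on the fibres over `Q`. -/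
lemma mul_freq_le_freq_prod {P : Ω → Ω' → Prop} {Q : Ω → Prop} {c : ℝ}
    (h : ∀ ω, Q ω → c ≤ freq (P ω)) : c * freq Q ≤ freq (fun ω : Ω × Ω' => P ω.1 ω.2) := by
  classical
  rw [freq_prod, freq, mul_div_assoc', Finset.mul_sum]
  refine div_le_div_of_nonneg_right (Finset.sum_le_sum fun ω _ => ?_) (Nat.cast_nonneg _)
  by_cases hQ : Q ω
  · simpa [hQ] using h ω hQ
  · simpa [hQ] using freq_nonneg (P ω)

lemma freq_equiv (e : Ω ≃ Ω') (P : Ω' → Prop) : freq (fun ω => P (e ω)) = freq P := by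
  classical
  unfold freq
  rw [Fintype.card_congr e, Equiv.sum_comp e fun ω => if P ω then (1 : ℝ) else 0]

/-- The image of a uniform element under a surjective homomorphism is uniform. -/
lemma freq_comp_surjective {G H : Type*} [AddGroup G] [AddGroup H] [Fintype G] [Fintype H]
    (φ : G → H) (hadd : ∀ a b, φ (a + b) = φ a + φ b) (hφ : Function.Surjective φ)
    (P : H → Prop) : freq (fun g => P (φ g)) = freq P := by
  classical
  let Φ : G →+ H := AddMonoidHom.mk' φ hadd
  have hfib : ∀ y, (Finset.univ.filter fun g => φ g = y).card =
      (Finset.univ.filter fun g => φ g = 0).card := by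
    intro y
    obtain ⟨g0, rfl⟩ := hφ y
    refine Finset.card_bij' (fun g _ => g - g0) (fun g _ => g + g0) ?_ ?_ ?_ ?_
    · intro g hg
      simp only [Finset.mem_filter, Finset.mem_univ, true_and] at hg ⊢
      have := Φ.map_sub g g0
      change φ (g - g0) = φ g - φ g0 at this
      rw [this, hg, sub_self]
    · intro g hg
      simp only [Finset.mem_filter, Finset.mem_univ, true_and] at hg ⊢
      rw [hadd, hg, zero_add]
    · intro g _
      simp
    · intro g _
      simp
  set K := (Finset.univ.filter fun g => φ g = 0).card with hK
  have hKpos : (0 : ℝ) < K := by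
    have : 0 < K := by
      rw [hK, Finset.card_pos]
      exact ⟨0, Finset.mem_filter.2 ⟨Finset.mem_univ _, Φ.map_zero⟩⟩
    exact_mod_cast this
  have hsum : ∀ w : H → ℝ, ∑ g, w (φ g) = K * ∑ y, w y := by
    intro w
    rw [← Finset.sum_fiberwise Finset.univ φ fun g => w (φ g), Finset.mul_sum]
    refine Finset.sum_congr rfl fun y _ => ?_
    rw [Finset.sum_congr rfl (g := fun _ => w y)]
    · rw [Finset.sum_const, hfib y, nsmul_eq_mul]
    · intro g hg
      rw [(Finset.mem_filter.1 hg).2]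
  have hcard : (Fintype.card G : ℝ) = K * Fintype.card H := by
    simpa using hsum fun _ => 1
  unfold freq
  rw [hsum fun y => if P y then (1 : ℝ) else 0, hcard, mul_div_mul_left _ _ hKpos.ne']

lemma freq_add_left {G : Type*} [AddGroup G] [Fintype G] (c : G) (P : G → Prop) :
    freq (fun g => P (c + g)) = freq P :=
  freq_equiv (Equiv.addLeft c) P

lemma freq_fst [Nonempty Ω'] (P : Ω → Prop) : freq (fun ω : Ω × Ω' => P ω.1) = freq P := by
  classical
  have h : (Fintype.card Ω' : ℝ) ≠ 0 := by simp
  rw [freq_prod fun ω _ => P ω, freq]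
  congr 1
  refine Finset.sum_congr rfl fun ω _ => ?_
  rw [freq]
  by_cases hP : P ω <;> simp [hP, h]

lemma freq_pi_forall (P : Ω → Prop) (R : ℕ) :
    freq (fun ω : Fin R → Ω => ∀ r, P (ω r)) = freq P ^ R := by
  classical
  rw [freq_eq_card_div, freq_eq_card_div, div_pow]
  congr 1
  · have : (Finset.univ.filter fun ω : Fin R → Ω => ∀ r, P (ω r)) =
        Fintype.piFinset fun _ => Finset.univ.filter P := by
      ext ω
      simp
    rw [this, Fintype.card_piFinset]
    simp
  · simp

end Freq

/-! ### Self-correction for affine-invariant sparse constraints. -/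

section SelfCorrection

variable {F V κ : Type*} [Field F] [AddCommGroup V] [Module F V] [Fintype κ]

/-- The affine map `F^κ → V` that takes the value `x` at `c` and has the linear part `b`. -/
def affinePt (c : κ → F) (x : V) (b : κ → V) (u : κ → F) : V := x + ∑ i, (u i - c i) • b i

lemma affinePt_self (c : κ → F) (x : V) (b : κ → V) : affinePt c x b c = x := by
  simp [affinePt]

lemma exists_sum_smul_eq {w : κ → F} (hw : w ≠ 0) (y : V) : ∃ b : κ → V, ∑ i, w i • b i = y := by
  classical
  obtain ⟨i, hi⟩ := Function.ne_iff.1 hw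
  refine ⟨Pi.single i ((w i)⁻¹ • y), ?_⟩
  rw [Finset.sum_eq_single i]
  · rw [Pi.single_eq_same, smul_smul, mul_inv_cancel₀ hi, one_smul]
  · intro j _ hj
    rw [Pi.single_eq_of_ne hj, smul_zero]
  · simp

/-- The rows and the columns of a bi-affine array of points are images under affine maps. -/
lemma affinePt_affinePt (c : κ → F) (x : V) (a b : κ → V) (q : κ → κ → V) (u v : κ → F) :
    affinePt c (affinePt c x a u) (fun j => b j + ∑ i, (u i - c i) • q j i) v =
      affinePt c (affinePt c x b v) (a + ∑ j, (v j - c j) • q j) u := by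
  simp only [affinePt, Pi.add_apply, Finset.sum_apply, Pi.smul_apply, smul_add, Finset.smul_sum,
    Finset.sum_add_distrib]
  rw [Finset.sum_comm]
  simp only [smul_smul, mul_comm]
  abel

variable [Fintype F] [DecidableEq κ]

/-- A constraint `μ` fails on the composition of `f` with the affine map `(x, b)`. -/
def ViolatedAt (Γ : Set ((κ → F) → F)) (c : κ → F) (f : V → F) (ω : V × (κ → V)) : Prop :=
  ∃ μ ∈ Γ, ∑ u, μ u * f (affinePt c ω.1 ω.2 u) ≠ 0

/-- The value at `x` that the constraint `μ` with `μ c ≠ 0` extrapolates from the image of `f`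
under the affine map `(x, b)`. -/
def extrapolate [DecidableEq F] (μ : (κ → F) → F) (c : κ → F) (f : V → F) (x : V) (b : κ → V) : F :=
  -(μ c)⁻¹ * ∑ u ∈ Finset.univ.erase c, μ u * f (affinePt c x b u)

variable {Γ : Set ((κ → F) → F)} {μ : (κ → F) → F} {c : κ → F} {f : V → F}

lemma extrapolate_mul [DecidableEq F] (hμ : μ c ≠ 0) (x : V) (b : κ → V) :
    μ c * extrapolate μ c f x b = -∑ u ∈ Finset.univ.erase c, μ u * f (affinePt c x b u) := by
  rw [extrapolate, ← mul_assoc, mul_neg, mul_inv_cancel₀ hμ, neg_one_mul]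

lemma eq_extrapolate [DecidableEq F] (hμ : μ ∈ Γ) (hc : μ c ≠ 0) {x : V} {b : κ → V}
    (h : ¬ ViolatedAt Γ c f (x, b)) : f x = extrapolate μ c f x b := by
  have h1 : ∑ u, μ u * f (affinePt c x b u) = 0 := by
    by_contra hne
    exact h ⟨μ, hμ, hne⟩
  rw [← Finset.add_sum_erase _ _ (Finset.mem_univ c), affinePt_self] at h1
  refine mul_left_cancel₀ hc ?_
  rw [extrapolate_mul hc]
  exact eq_neg_of_add_eq_zero_left h1

variable [Fintype V]

/-- A column off the centre is a uniform affine map even for fixed `a`: with `w ≠ 0`, `b` randomizes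
its base point and `q` its directions. The self-correction argument needs this for one given `a`. -/
lemma freq_violatedAt_column {w : κ → F} (hw : w ≠ 0) (y : V) (a : κ → V) :
    freq (fun ω : (κ → V) × (κ → κ → V) =>
      ViolatedAt Γ c f (y + ∑ j, w j • ω.1 j, a + ∑ j, w j • ω.2 j)) =
    freq (ViolatedAt Γ c f) := by
  rw [← freq_add_left (y, a)]
  refine freq_comp_surjective (fun ω : (κ → V) × (κ → κ → V) =>
    ((∑ j, w j • ω.1 j, ∑ j, w j • ω.2 j) : V × (κ → V))) ?_ ?_
    (fun ω => ViolatedAt Γ c f ((y, a) + ω))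
  · intro ω ω'
    simp [smul_add, Finset.sum_add_distrib]
  · rintro ⟨y, a⟩
    obtain ⟨b, hb⟩ := exists_sum_smul_eq hw y
    obtain ⟨q, hq⟩ := exists_sum_smul_eq hw a
    exact ⟨(b, q), Prod.ext hb hq⟩

/-- Here the first component randomizes the base point and the second alone the directions. -/
lemma freq_violatedAt_row {w : κ → F} (hw : w ≠ 0) (y : V) :
    freq (fun ω : (κ → V) × (κ → V) × (κ → κ → V) =>
      ViolatedAt Γ c f (y + ∑ i, w i • ω.1 i, fun j => ω.2.1 j + ∑ i, w i • ω.2.2 j i)) =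
    freq (ViolatedAt Γ c f) := by
  rw [← freq_add_left ((y, 0) : V × (κ → V))]
  rw [← freq_comp_surjective (fun ω : (κ → V) × (κ → V) × (κ → κ → V) =>
    ((∑ i, w i • ω.1 i, fun j => ω.2.1 j + ∑ i, w i • ω.2.2 j i) : V × (κ → V))) ?_ ?_
    (fun ω => ViolatedAt Γ c f ((y, 0) + ω))]
  · simp
  · intro ω ω'
    refine Prod.ext ?_ ?_
    · simp [smul_add, Finset.sum_add_distrib]
    · ext j
      simp only [Prod.fst_add, Prod.snd_add, Pi.add_apply, smul_add, Finset.sum_add_distrib]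
      abel
  · rintro ⟨y, a⟩
    obtain ⟨b, hb⟩ := exists_sum_smul_eq hw y
    exact ⟨(b, a, 0), Prod.ext hb (by ext; simp)⟩

variable [DecidableEq F]

/-- The support of a constraint without the point where one extrapolates. -/
def offSupport (μ : (κ → F) → F) (c : κ → F) : Finset (κ → F) :=
  (Finset.univ.erase c).filter fun u => μ u ≠ 0

lemma sub_ne_zero_of_mem_offSupport {u : κ → F} (hu : u ∈ offSupport μ c) :
    (fun i => u i - c i) ≠ 0 := by
  intro h
  refine Finset.ne_of_mem_erase (Finset.mem_filter.1 hu).1 ?_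
  ext i
  exact sub_eq_zero.1 (congrFun h i)

lemma sum_erase_congr {g h : (κ → F) → F} (H : ∀ u ∈ offSupport μ c, g u = h u) :
    ∑ u ∈ Finset.univ.erase c, μ u * g u = ∑ u ∈ Finset.univ.erase c, μ u * h u := by
  refine Finset.sum_congr rfl fun u hu => ?_
  by_cases h0 : μ u = 0
  · simp [h0]
  · rw [H u (Finset.mem_filter.2 ⟨hu, h0⟩)]

/-- Two independent extrapolations to the same point agree unless a row or a column of a random
bi-affine array violates a constraint. -/
lemma freq_extrapolate_ne_le (hμ : μ ∈ Γ) (hc : μ c ≠ 0) (x : V) :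
    freq (fun ω : (κ → V) × (κ → V) => extrapolate μ c f x ω.1 ≠ extrapolate μ c f x ω.2) ≤
      2 * (offSupport μ c).card * freq (ViolatedAt Γ c f) := by
  have h0 : freq (fun ω : (κ → V) × (κ → V) =>
        extrapolate μ c f x ω.1 ≠ extrapolate μ c f x ω.2) =
      freq (fun ω : (κ → V) × (κ → V) × (κ → κ → V) =>
        extrapolate μ c f x ω.1 ≠ extrapolate μ c f x ω.2.1) := by
    refine (freq_comp_surjective (fun ω : (κ → V) × (κ → V) × (κ → κ → V) => (ω.1, ω.2.1))
      (fun _ _ => rfl) ?_ (fun ω : (κ → V) × (κ → V) =>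
        extrapolate μ c f x ω.1 ≠ extrapolate μ c f x ω.2)).symm
    rintro ⟨a, b⟩
    exact ⟨(a, b, 0), rfl⟩
  set row : (κ → F) → (κ → V) × (κ → V) × (κ → κ → V) → V × (κ → V) := fun u ω =>
    (affinePt c x ω.1 u, fun j => ω.2.1 j + ∑ i, (u i - c i) • ω.2.2 j i) with hrow
  set col : (κ → F) → (κ → V) × (κ → V) × (κ → κ → V) → V × (κ → V) := fun v ω =>
    (affinePt c x ω.2.1 v, ω.1 + ∑ j, (v j - c j) • ω.2.2 j) with hcol
  have hbad : ∀ ω : (κ → V) × (κ → V) × (κ → κ → V),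
      extrapolate μ c f x ω.1 ≠ extrapolate μ c f x ω.2.1 →
      (∃ u ∈ offSupport μ c, ViolatedAt Γ c f (row u ω)) ∨
        ∃ v ∈ offSupport μ c, ViolatedAt Γ c f (col v ω) := by
    rintro ⟨a, b, q⟩ hne
    by_contra hcon
    push Not at hcon
    apply hne
    -- After two factors `μ c`, both extrapolations become the same double sum of `μ u * μ v * f`
    -- over the array, summed by rows and by columns.
    refine mul_left_cancel₀ hc (mul_left_cancel₀ hc ?_)
    rw [extrapolate_mul hc, extrapolate_mul hc]
    rw [sum_erase_congr fun u hu => eq_extrapolate hμ hc (hcon.1 u hu),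
      sum_erase_congr fun u hu => eq_extrapolate hμ hc (hcon.2 u hu)]
    simp only [mul_neg, Finset.mul_sum, neg_inj]
    simp only [mul_left_comm (μ c), extrapolate_mul hc]
    simp only [mul_neg, Finset.mul_sum, Finset.sum_neg_distrib, neg_inj]
    rw [Finset.sum_comm]
    refine Finset.sum_congr rfl fun v _ => Finset.sum_congr rfl fun u _ => ?_
    rw [affinePt_affinePt, mul_left_comm]
  rw [h0]
  refine (freq_mono hbad).trans ((freq_or_le _ _).trans ?_)
  have h1 : ∀ u ∈ offSupport μ c, freq (fun ω => ViolatedAt Γ c f (row u ω)) ≤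
      freq (ViolatedAt Γ c f) := fun u hu =>
    (freq_violatedAt_row (sub_ne_zero_of_mem_offSupport hu) x).le
  have h2 : ∀ v ∈ offSupport μ c, freq (fun ω => ViolatedAt Γ c f (col v ω)) ≤
      freq (ViolatedAt Γ c f) := fun v hv =>
    freq_prod_le (P := fun a (ω : (κ → V) × (κ → κ → V)) => ViolatedAt Γ c f (col v (a, ω)))
      (freq_nonneg _)
      fun a => (freq_violatedAt_column (sub_ne_zero_of_mem_offSupport hv) x a).le
  have h3 := (freq_exists_le (offSupport μ c) fun u ω => ViolatedAt Γ c f (row u ω)).trans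
    (Finset.sum_le_sum h1)
  have h4 := (freq_exists_le (offSupport μ c) fun u ω => ViolatedAt Γ c f (col u ω)).trans
    (Finset.sum_le_sum h2)
  rw [Finset.sum_const, nsmul_eq_mul] at h3 h4
  linarith

/-- Self-correction: a function that violates a family of sparse constraints on the image of a
random affine map with a small probability is close to a function that satisfies all of them on the
image of every affine map. -/
theorem exists_close_of_freq_violatedAt {s : ℕ} (hs : 2 ≤ s)
    (hΓ : ∀ μ ∈ Γ, (Finset.univ.filter fun u => μ u ≠ 0).card ≤ s) (hμ : μ ∈ Γ) (hc : μ c ≠ 0)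
    (hη : 2 * (s : ℝ) ^ 2 * freq (ViolatedAt Γ c f) < 1) :
    ∃ g : V → F, (∀ ω, ¬ ViolatedAt Γ c g ω) ∧
      freq (fun x => f x ≠ g x) ≤ 2 * freq (ViolatedAt Γ c f) := by
  set η := freq (ViolatedAt Γ c f) with hηdef
  have hη0 : 0 ≤ η := freq_nonneg _
  have hcard : ((offSupport μ c).card : ℝ) ≤ s - 1 := by
    have h1 : (offSupport μ c).card < (Finset.univ.filter fun u => μ u ≠ 0).card := by
      refine Finset.card_lt_card (Finset.ssubset_iff.2 ⟨c, by simp [offSupport], ?_⟩)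
      intro u hu
      rcases Finset.mem_insert.1 hu with rfl | hu
      · simpa using hc
      · exact Finset.mem_filter.2 ⟨Finset.mem_univ _, (Finset.mem_filter.1 hu).2⟩
    have h2 := h1.trans_le (hΓ μ hμ)
    have h3 : ((offSupport μ c).card + 1 : ℝ) ≤ s := by exact_mod_cast h2
    linarith
  have hs' : (2 : ℝ) ≤ s := by exact_mod_cast hs
  set N : ℝ := ((offSupport μ c).card : ℝ) with hN
  have hN0 : 0 ≤ N := Nat.cast_nonneg _
  -- By averaging, some direction `b'` extrapolates to a value that most directions reproduce; this
  -- replaces a majority vote.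
  have hex : ∀ x, ∃ b' : κ → V,
      freq (fun b => extrapolate μ c f x b' ≠ extrapolate μ c f x b) ≤ 2 * N * η := fun x =>
    exists_freq_le (freq_extrapolate_ne_le hμ hc x)
  choose b' hb' using hex
  set g : V → F := fun x => extrapolate μ c f x (b' x) with hg
  have hsmall : 2 * N * η ≤ 1 / 2 := by
    have : 2 * N * η ≤ 2 * (s - 1) * η := by gcongr
    nlinarith [sq_nonneg ((s : ℝ) - 2)]
  refine ⟨g, ?_, ?_⟩
  · rintro ⟨x, a⟩ ⟨ν, hν, hne⟩
    -- The rows of the array now start at the fixed points where `ν` tests `g`; the columns off the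
    -- centre are random affine maps on which `f` is tested.
    set W : Finset (κ → F) := Finset.univ.filter fun u => ν u ≠ 0 with hW
    set row : (κ → F) → (κ → V) × (κ → κ → V) → κ → V := fun u ω j =>
      ω.1 j + ∑ i, (u i - c i) • ω.2 j i with hrow
    set col : (κ → F) → (κ → V) × (κ → κ → V) → V × (κ → V) := fun v ω =>
      (affinePt c x ω.1 v, a + ∑ j, (v j - c j) • ω.2 j) with hcol
    have h1 : ∀ u ∈ W, freq (fun ω => g (affinePt c x a u) ≠
        extrapolate μ c f (affinePt c x a u) (row u ω)) ≤ 2 * N * η := by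
      intro u _
      refine le_of_eq_of_le ?_ (hb' (affinePt c x a u))
      refine freq_comp_surjective (row u) ?_ ?_
        (fun b => g (affinePt c x a u) ≠ extrapolate μ c f (affinePt c x a u) b)
      · intro ω ω'
        ext j
        simp only [hrow, Prod.fst_add, Prod.snd_add, Pi.add_apply, smul_add,
          Finset.sum_add_distrib]
        abel
      · intro b
        exact ⟨(b, 0), by ext; simp [hrow]⟩
    have h2 : ∀ v ∈ offSupport μ c, freq (fun ω => ViolatedAt Γ c f (col v ω)) ≤ η := fun v hv =>
      (freq_violatedAt_column (sub_ne_zero_of_mem_offSupport hv) x a).le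
    have h3 := (freq_exists_le W fun u ω => g (affinePt c x a u) ≠
      extrapolate μ c f (affinePt c x a u) (row u ω)).trans (Finset.sum_le_sum h1)
    have h4 := (freq_exists_le (offSupport μ c) fun u ω => ViolatedAt Γ c f (col u ω)).trans
      (Finset.sum_le_sum h2)
    rw [Finset.sum_const, nsmul_eq_mul] at h3 h4
    have h5 := (freq_or_le _ _).trans (add_le_add h3 h4)
    have hWs : (W.card : ℝ) ≤ s := by exact_mod_cast hΓ ν hν
    -- Union bound: `g` may differ from the extrapolation along a row, or a column may be violated.
    -- Some array avoids both.
    have h6 : (W.card : ℝ) * (2 * N * η) + N * η < 1 := by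
      calc (W.card : ℝ) * (2 * N * η) + N * η ≤ s * (2 * (s - 1) * η) + (s - 1) * η := by gcongr
        _ ≤ 2 * (s : ℝ) ^ 2 * η := by nlinarith
        _ < 1 := hη
    obtain ⟨ω, hω⟩ := exists_not_of_freq_lt_one (h5.trans_lt h6)
    push Not at hω
    apply hne
    -- Expanding `g` along the rows and exchanging the sums leaves the constraint `ν` for `f` on the
    -- columns, where it holds.
    have key : μ c * ∑ u, ν u * g (affinePt c x a u) = 0 := by
      calc μ c * ∑ u, ν u * g (affinePt c x a u)
          = ∑ u, ν u * (μ c * extrapolate μ c f (affinePt c x a u) (row u ω)) := by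
            rw [Finset.mul_sum]
            refine Finset.sum_congr rfl fun u _ => ?_
            by_cases hu : ν u = 0
            · simp [hu]
            · rw [hω.1 u (Finset.mem_filter.2 ⟨Finset.mem_univ _, hu⟩), mul_left_comm]
        _ = -∑ v ∈ Finset.univ.erase c,
              μ v * ∑ u, ν u * f (affinePt c (col v ω).1 (col v ω).2 u) := by
            simp only [extrapolate_mul hc, mul_neg, Finset.sum_neg_distrib, Finset.mul_sum]
            rw [Finset.sum_comm, neg_inj]
            refine Finset.sum_congr rfl fun v _ => Finset.sum_congr rfl fun u _ => ?_
            rw [hrow, affinePt_affinePt, mul_left_comm]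
        _ = 0 := by
            rw [neg_eq_zero]
            refine Finset.sum_eq_zero fun v hv => ?_
            by_cases h0 : μ v = 0
            · rw [h0, zero_mul]
            · have := hω.2 v (Finset.mem_filter.2 ⟨hv, h0⟩)
              have h7 : ∑ u, ν u * f (affinePt c (col v ω).1 (col v ω).2 u) = 0 := by
                by_contra h8
                exact this ⟨ν, hν, h8⟩
              rw [h7, mul_zero]
    exact (mul_eq_zero.1 key).resolve_left hc
  -- Where `f x ≠ g x`, every direction whose extrapolation gives `g x` exhibits a violation, and
  -- these are at least half of all.
  · have h1 : ∀ x, f x ≠ g x → 1 / 2 ≤ freq fun b => ViolatedAt Γ c f (x, b) := by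
      intro x hx
      have h2 : freq (fun b => ¬ (g x ≠ extrapolate μ c f x b)) ≤
          freq fun b => ViolatedAt Γ c f (x, b) := by
        refine freq_mono fun b hb => ?_
        by_contra hv
        exact hx ((eq_extrapolate hμ hc hv).trans (not_not.1 hb).symm)
      rw [freq_not] at h2
      have := hb' x
      linarith
    have := mul_freq_le_freq_prod (P := fun x b => ViolatedAt Γ c f (x, b)) h1
    change 1 / 2 * _ ≤ η at this
    linarith

end SelfCorrection

/-! ### Random evaluation points and sparse linear relations. -/

section Interpolation

open Module

variable {F X : Type*} [Field F] [Fintype X]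

/-- Random points determine the elements of a space of functions: a nonzero function survives `N`
random evaluations with frequency at most `finrank W / (N c)` if every nonzero function is nonzero
with frequency at least `c`. -/
lemma mul_freq_exists_vanishing_le {c : ℝ} (hc0 : 0 ≤ c) (N : ℕ) (W : Submodule F (X → F))
    (hW : ∀ w ∈ W, w ≠ 0 → c ≤ freq fun x => w x ≠ 0) :
    N * c * freq (fun y : Fin N → X => ∃ w ∈ W, w ≠ 0 ∧ ∀ j, w (y j) = 0) ≤ finrank F W := by
  classical
  induction N generalizing W with
  | zero => simp
  | succ N ih =>
    by_cases hbot : W = ⊥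
    · have : freq (fun y : Fin (N + 1) → X => ∃ w ∈ W, w ≠ 0 ∧ ∀ j, w (y j) = 0) = 0 := by
        rw [← freq_false (Ω := Fin (N + 1) → X)]
        congr 1
        ext y
        simp only [iff_false]
        rintro ⟨w, hw, hw0, -⟩
        rw [hbot, Submodule.mem_bot] at hw
        exact hw0 hw
      rw [this, mul_zero]
      exact Nat.cast_nonneg _
    · obtain ⟨w0, hw0, hne⟩ := W.ne_bot_iff.1 hbot
      let Wx : X → Submodule F (X → F) := fun x => W ⊓ LinearMap.ker (LinearMap.proj x)
      have hsplit : freq (fun y : Fin (N + 1) → X => ∃ w ∈ W, w ≠ 0 ∧ ∀ j, w (y j) = 0) =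
          freq (fun ω : X × (Fin N → X) => ∃ w ∈ Wx ω.1, w ≠ 0 ∧ ∀ j, w (ω.2 j) = 0) := by
        rw [← freq_equiv (Fin.consEquiv fun _ : Fin (N + 1) => X)]
        congr 1
        ext ω
        simp only [Fin.consEquiv, Equiv.coe_fn_mk, Fin.forall_fin_succ, Fin.cons_zero,
          Fin.cons_succ, Wx, Submodule.mem_inf, LinearMap.mem_ker, LinearMap.proj_apply]
        constructor
        · rintro ⟨w, h1, h2, h3, h4⟩
          exact ⟨w, ⟨h1, h3⟩, h2, h4⟩
        · rintro ⟨w, ⟨h1, h3⟩, h2, h4⟩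
          exact ⟨w, h1, h2, h3, h4⟩
      rcases isEmpty_or_nonempty X with hX | hX
      · exact absurd (Subsingleton.elim w0 0) hne
      have hcard : (0 : ℝ) < Fintype.card X := by exact_mod_cast Fintype.card_pos
      -- A first point with `w0 x ≠ 0` lowers the dimension by at least one, which happens with
      -- frequency at least `c`. This gain pays for passing from `N` to `N + 1`.
      have hx : ∀ x, N * c * freq (fun y : Fin N → X => ∃ w ∈ Wx x, w ≠ 0 ∧ ∀ j, w (y j) = 0) ≤
          finrank F W - if w0 x ≠ 0 then 1 else 0 := by
        intro x
        have h1 := ih (Wx x) fun w hw => hW w hw.1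
        split_ifs with hwx
        · have h2 : finrank F (Wx x) < finrank F W := by
            refine Submodule.finrank_lt_finrank_of_lt (lt_of_le_of_ne inf_le_left ?_)
            intro heq
            have : w0 ∈ Wx x := heq ▸ hw0
            exact hwx this.2
          have h3 : (finrank F (Wx x) : ℝ) + 1 ≤ finrank F W := by exact_mod_cast h2
          linarith
        · have h2 : finrank F (Wx x) ≤ finrank F W := Submodule.finrank_mono inf_le_left
          have h3 : (finrank F (Wx x) : ℝ) ≤ finrank F W := by exact_mod_cast h2
          linarith
      have h1 : N * c * freq (fun y : Fin (N + 1) → X => ∃ w ∈ W, w ≠ 0 ∧ ∀ j, w (y j) = 0) ≤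
          finrank F W - freq fun x => w0 x ≠ 0 := by
        rw [hsplit, freq_prod fun x (y : Fin N → X) => ∃ w ∈ Wx x, w ≠ 0 ∧ ∀ j, w (y j) = 0, mul_div_assoc',
          Finset.mul_sum, div_le_iff₀ hcard, freq]
        refine (Finset.sum_le_sum fun x _ => hx x).trans_eq ?_
        rw [Finset.sum_sub_distrib, sub_mul, div_mul_cancel₀ _ hcard.ne']
        simp [mul_comm]
        congr!
      have h2 := hW w0 hw0 hne
      have h3 : c * freq (fun y : Fin (N + 1) → X => ∃ w ∈ W, w ≠ 0 ∧ ∀ j, w (y j) = 0) ≤ c :=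
        mul_le_of_le_one_right hc0 (freq_le_one _)
      push_cast
      linarith

/-- A function that satisfies all sparse linear relations that hold on `W` for the evaluations at
the points `y` agrees with an element of `W` on these points. -/
lemma exists_mem_eq_of_sparse_relations (W : Submodule F (X → F)) {ι : Type*} (y : ι → X) {s : ℕ}
    (hs : finrank F W + 1 ≤ s) [DecidableEq F] [DecidableEq X] (g : X → F)
    (hg : ∀ μ : X → F, (Finset.univ.filter fun u => μ u ≠ 0).card ≤ s →
      (∀ u, μ u ≠ 0 → u ∈ Set.range y) → (∀ w ∈ W, ∑ u, μ u * w u = 0) → ∑ u, μ u * g u = 0) :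
    ∃ w ∈ W, ∀ j, w (y j) = g (y j) := by
  classical
  let v : ι → Dual F W := fun j => (LinearMap.proj (y j)).comp W.subtype
  have hv : ∀ j (w : W), v j w = (w : X → F) (y j) := fun _ _ => rfl
  -- A basis of the span of the evaluation functionals: at most `finrank F W` points, on which `g`
  -- can be interpolated by an element of `W`.
  obtain ⟨I, a, -, hspan, hli⟩ := exists_linearIndependent' F v
  have : Finite I := LinearIndependent.finite hli
  have : Fintype I := Fintype.ofFinite I
  have hI : Fintype.card I ≤ finrank F W := by
    rw [← Subspace.dual_finrank_eq]
    exact hli.fintype_card_le_finrank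
  obtain ⟨Φ, hΦ⟩ := LinearMap.exists_extend ((Basis.span hli).constr F fun i => g (y (a i)))
  have hΦ' : ∀ i, Φ (v (a i)) = g (y (a i)) := by
    intro i
    have h1 := LinearMap.congr_fun hΦ (Basis.span hli i)
    rw [Basis.constr_basis, LinearMap.comp_apply, Submodule.subtype_apply, Basis.span_apply] at h1
    exact h1
  set w := (evalEquiv F W).symm Φ with hw
  have hwv : ∀ φ : Dual F W, φ w = Φ φ := fun φ => apply_evalEquiv_symm_apply F W φ Φ
  refine ⟨w, w.2, fun j => ?_⟩
  have hj : v j ∈ Submodule.span F (Set.range (v ∘ a)) := by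
    rw [hspan]
    exact Submodule.subset_span ⟨j, rfl⟩
  obtain ⟨q, hq⟩ := (Submodule.mem_span_range_iff_exists_fun F).1 hj
  -- The relation expressing evaluation at `y j` through the basis points; it carries the agreement
  -- of `w` and `g` over to `y j`.
  set μ : X → F := Pi.single (y j) 1 - ∑ i, q i • Pi.single (y (a i)) 1 with hμ
  have hsum : ∀ h : X → F, ∑ u, μ u * h u = h (y j) - ∑ i, q i * h (y (a i)) := by
    intro h
    simp only [hμ, Pi.sub_apply, Finset.sum_apply, Pi.smul_apply, smul_eq_mul, sub_mul,
      Finset.sum_sub_distrib, Finset.sum_mul]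
    rw [Finset.sum_comm]
    simp [Pi.single_apply]
  have hsupp : ∀ u, μ u ≠ 0 → u ∈ insert (y j) (Finset.univ.image fun i => y (a i)) := by
    intro u hu
    by_contra hcon
    simp only [Finset.mem_insert, Finset.mem_image, Finset.mem_univ, true_and, not_or,
      not_exists] at hcon
    apply hu
    have h2 : ∀ i, u ≠ y (a i) := fun i h => hcon.2 i h.symm
    simp [hμ, hcon.1, h2]
  have hrel : ∀ w' ∈ W, ∑ u, μ u * w' u = 0 := by
    intro w' hw'
    have h1 := LinearMap.congr_fun hq ⟨w', hw'⟩
    simp only [LinearMap.sum_apply, LinearMap.smul_apply, Function.comp_apply, hv,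
      smul_eq_mul] at h1
    rw [hsum, h1, sub_self]
  have key := hg μ ?_ ?_ hrel
  · rw [hsum] at key
    have h1 := hrel w w.2
    rw [hsum] at h1
    have h2 : ∀ i, (w : X → F) (y (a i)) = g (y (a i)) := fun i => by
      rw [← hv, hwv, hΦ']
    simp only [h2] at h1
    rw [sub_eq_zero] at h1 key
    rw [h1, key]
  · calc (Finset.univ.filter fun u => μ u ≠ 0).card
        ≤ (insert (y j) (Finset.univ.image fun i => y (a i))).card :=
          Finset.card_le_card fun u hu => hsupp u (Finset.mem_filter.1 hu).2
      _ ≤ (Finset.univ.image fun i => y (a i)).card + 1 := Finset.card_insert_le _ _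
      _ ≤ Fintype.card I + 1 := by
          gcongr
          exact Finset.card_image_le
      _ ≤ s := (Nat.add_le_add_right hI 1).trans hs
  · intro u hu
    rcases Finset.mem_insert.1 (hsupp u hu) with rfl | h
    · exact ⟨j, rfl⟩
    · obtain ⟨i, -, rfl⟩ := Finset.mem_image.1 h
      exact ⟨a i, rfl⟩

end Interpolation

/-! ### Local characterization of degree. -/

section Characterization

variable {p : ℕ} [Fact p.Prime] {ι κ : Type*}

lemma isAffineMap_affinePt [Fintype κ] (c : κ → ZMod p) (x : ι → ZMod p) (b : κ → ι → ZMod p) :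
    IsAffineMap (affinePt c x b) := by
  intro j
  have : (fun u : κ → ZMod p => affinePt c x b u j) =
      (fun _ => x j) + ∑ i, b i j • ((fun u : κ → ZMod p => u i) - fun _ => c i) := by
    ext u
    simp [affinePt, mul_comm]
  rw [this]
  exact add_mem (const_mem_affineFunctions _) (Submodule.sum_mem _ fun i _ =>
    Submodule.smul_mem _ _ (sub_mem (coord_mem_affineFunctions i) (const_mem_affineFunctions _)))

/-- The iterated difference along a list of directions. -/
def iteratedFwdDiff (l : List (κ → ZMod p)) (g : (κ → ZMod p) → ZMod p) :
    (κ → ZMod p) → ZMod p :=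
  l.foldl (fun g h => fwdDiff h g) g

lemma iteratedFwdDiff_cons (h : κ → ZMod p) (l : List (κ → ZMod p))
    (g : (κ → ZMod p) → ZMod p) :
    iteratedFwdDiff (h :: l) g = iteratedFwdDiff l (fwdDiff h g) := rfl

lemma mem_polyDeg_of_iteratedFwdDiff [Fintype κ] {m : ℕ} {g : (κ → ZMod p) → ZMod p}
    (hg : ∀ v : Fin (m + 1) → κ → ZMod p, iteratedFwdDiff (List.ofFn v) g = 0) :
    g ∈ polyDeg p κ m := by
  induction m generalizing g with
  | zero => exact eq_const_of_fwdDiff_eq_zero fun h => by simpa [iteratedFwdDiff] using hg fun _ => h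
  | succ m ih =>
    refine mem_polyDeg_of_fwdDiff fun h => ih fun v => ?_
    rw [← iteratedFwdDiff_cons, ← List.ofFn_cons]
    exact hg _

lemma iteratedFwdDiff_eq_zero {m : ℕ} {g : (κ → ZMod p) → ZMod p} (hg : g ∈ polyDeg p κ m)
    (v : Fin (m + 1) → κ → ZMod p) : iteratedFwdDiff (List.ofFn v) g = 0 := by
  induction m generalizing g with
  | zero => simpa [iteratedFwdDiff] using fwdDiff_mem_polyDeg_zero hg (v 0)
  | succ m ih =>
    rw [List.ofFn_succ, iteratedFwdDiff_cons]
    exact ih (fwdDiff_mem_polyDeg hg _) _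

lemma iteratedFwdDiff_comp [Fintype κ] (x : ι → ZMod p) (b : κ → ι → ZMod p)
    (l : List (κ → ZMod p)) (g : (ι → ZMod p) → ZMod p) :
    iteratedFwdDiff l (g ∘ affinePt 0 x b) =
      iteratedFwdDiff (l.map (affinePt 0 0 b)) g ∘ affinePt 0 x b := by
  induction l generalizing g with
  | nil => rfl
  | cons u l ih =>
    rw [List.map_cons, iteratedFwdDiff_cons, iteratedFwdDiff_cons, ← ih]
    congr 1
    ext v
    have : affinePt 0 x b (v + u) = affinePt 0 x b v + affinePt 0 0 b u := by
      simp [affinePt, add_smul, Finset.sum_add_distrib, add_assoc]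
    simp [fwdDiff, this]

/-- A function has degree at most `d` if its restrictions to affine images of a space of dimension
greater than `d` have. -/
lemma mem_polyDeg_of_comp [Fintype ι] [Fintype κ] {d : ℕ} (hd : d + 1 ≤ Fintype.card κ)
    {g : (ι → ZMod p) → ZMod p}
    (hg : ∀ x b, g ∘ affinePt (0 : κ → ZMod p) x b ∈ polyDeg p κ d) : g ∈ polyDeg p ι d := by
  classical
  refine mem_polyDeg_of_iteratedFwdDiff fun v => ?_
  ext x
  obtain ⟨e⟩ : Nonempty (Fin (d + 1) ↪ κ) := Function.Embedding.nonempty_of_card_le (by simpa)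
  -- This linear part sends `d + 1` unit vectors to the directions `v`, so the iterated difference
  -- of `g` at `x` is one of its restriction at `0`.
  set b : κ → ι → ZMod p := Function.extend e v 0 with hb
  have h1 := iteratedFwdDiff_eq_zero (hg x b) fun i => Pi.single (e i) 1
  rw [iteratedFwdDiff_comp, List.map_ofFn] at h1
  have h2 : (affinePt (0 : κ → ZMod p) 0 b ∘ fun i => (Pi.single (e i) 1 : κ → ZMod p)) = v := by
    ext i j
    simp only [Function.comp_apply, affinePt, zero_add, Pi.zero_apply, sub_zero]
    rw [Finset.sum_eq_single (e i)]
    · rw [Pi.single_eq_same, one_smul, hb, e.injective.extend_apply]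
    · intro k _ hk
      rw [Pi.single_eq_of_ne hk, zero_smul]
    · simp
  rw [h2] at h1
  have h3 := congrFun h1 0
  have h4 : affinePt (0 : κ → ZMod p) x b 0 = x := affinePt_self 0 x b
  rw [Function.comp_apply, h4] at h3
  exact h3

/-- If the points `y` determine the functions of degree at most `d + 1`, then a function has degree
at most `d` as soon as, composed with any affine map, it agrees on these points with a function of
degree at most `d`. -/
lemma mem_polyDeg_of_agrees [Fintype ι] [Fintype κ] {d : ℕ} (hd : d + 1 ≤ Fintype.card κ)
    {J : Type*} {y : J → κ → ZMod p}
    (hy : ∀ w ∈ polyDeg p κ (d + 1), (∀ j, w (y j) = 0) → w = 0)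
    {g : (ι → ZMod p) → ZMod p}
    (hg : ∀ x b, ∃ w ∈ polyDeg p κ d, ∀ j, w (y j) = g (affinePt 0 x b (y j))) :
    g ∈ polyDeg p ι d := by
  -- If `g` already has degree at most `d + 1`, its restriction and `w` agree on points that
  -- determine this degree, hence everywhere.
  have base : ∀ g : (ι → ZMod p) → ZMod p, g ∈ polyDeg p ι (d + 1) →
      (∀ x b, ∃ w ∈ polyDeg p κ d, ∀ j, w (y j) = g (affinePt 0 x b (y j))) →
      g ∈ polyDeg p ι d := by
    intro g hg1 hg
    refine mem_polyDeg_of_comp hd fun x b => ?_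
    obtain ⟨w, hw, hwy⟩ := hg x b
    have h1 := comp_mem_polyDeg (isAffineMap_affinePt 0 x b) hg1
    have h2 := hy (w - g ∘ affinePt 0 x b) (sub_mem (polyDeg_mono (Nat.le_succ d) hw) h1)
      fun j => by simp [hwy j]
    rwa [← sub_eq_zero.1 h2]
  obtain ⟨m, hm⟩ := exists_mem_polyDeg g
  -- Differences inherit the hypothesis, as `x` and `x + h` are both base points. By induction they
  -- have degree at most `d`, so `g` has degree at most `d + 1` and `base` applies.
  have key : ∀ e, d ≤ e → ∀ g : (ι → ZMod p) → ZMod p, g ∈ polyDeg p ι e →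
      (∀ x b, ∃ w ∈ polyDeg p κ d, ∀ j, w (y j) = g (affinePt 0 x b (y j))) →
      g ∈ polyDeg p ι d := by
    intro e he
    induction e, he using Nat.le_induction with
    | base => exact fun g h _ => h
    | succ e _ ih =>
      intro g hge hg
      refine base g (mem_polyDeg_of_fwdDiff fun h => ih _ (fwdDiff_mem_polyDeg hge h) ?_) hg
      intro x b
      obtain ⟨w, hw, hwy⟩ := hg x b
      obtain ⟨w', hw', hwy'⟩ := hg (x + h) b
      refine ⟨w' - w, sub_mem hw' hw, fun j => ?_⟩
      have : affinePt 0 (x + h) b (y j) = affinePt 0 x b (y j) + h := by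
        simp [affinePt, add_right_comm]
      simp [fwdDiff, hwy, hwy', this]
  exact key (max d m) (le_max_left _ _) g (polyDeg_mono (le_max_right _ _) hm) hg

end Characterization

/-! ### Success probability of one round. -/

section Round

variable {p : ℕ} [Fact p.Prime] {ι κ : Type*} [Fintype ι] [Fintype κ] [DecidableEq ι]
  [DecidableEq κ]

/-- With frequency at least one half, `Q` random points determine the functions of degree at most
`m`. -/
lemma half_le_freq_determining {m Q : ℕ}
    (hQ : 2 ^ (m + 1) * (Fintype.card κ + m).choose m ≤ Q) :
    1 / 2 ≤ freq fun y : Fin Q → κ → ZMod p =>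
      ∀ w ∈ polyDeg p κ m, (∀ j, w (y j) = 0) → w = 0 := by
  have hW : ∀ w ∈ polyDeg p κ m, w ≠ 0 → (1 / 2 ^ m : ℝ) ≤ freq fun x => w x ≠ 0 := by
    intro w hw h0
    have h1 := card_le_two_pow_mul_card_ne_zero hw h0
    have hc : (0 : ℝ) < Fintype.card (κ → ZMod p) := by exact_mod_cast Fintype.card_pos
    rw [freq_eq_card_div, div_le_div_iff₀ (by positivity) hc, one_mul, mul_comm]
    exact_mod_cast h1
  have h1 := mul_freq_exists_vanishing_le (by positivity) Q (polyDeg p κ m) hW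
  have h2 := freq_not fun y : Fin Q → κ → ZMod p => ∃ w ∈ polyDeg p κ m, w ≠ 0 ∧ ∀ j, w (y j) = 0
  set D := (Fintype.card κ + m).choose m with hD
  have hDpos : (0 : ℝ) < D := by exact_mod_cast Nat.choose_pos (Nat.le_add_left _ _)
  have h3 : (Module.finrank (ZMod p) (polyDeg p κ m) : ℝ) ≤ D := by
    exact_mod_cast finrank_polyDeg_le m
  set B := freq fun y : Fin Q → κ → ZMod p => ∃ w ∈ polyDeg p κ m, w ≠ 0 ∧ ∀ j, w (y j) = 0 with hB
  have hB0 : 0 ≤ B := freq_nonneg _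
  have hQ' : (2 : ℝ) ^ (m + 1) * D ≤ Q := by exact_mod_cast hQ
  have h4 : 2 * D * B ≤ D := by
    calc 2 * D * B = 2 ^ (m + 1) * D * (1 / 2 ^ m) * B := by
          rw [pow_succ]
          field_simp
      _ ≤ Q * (1 / 2 ^ m) * B := by gcongr
      _ ≤ D := h1.trans h3
  have h5 : B ≤ 1 / 2 := by nlinarith
  have h6 : 1 / 2 ≤ freq fun y : Fin Q → κ → ZMod p =>
      ¬ ∃ w ∈ polyDeg p κ m, w ≠ 0 ∧ ∀ j, w (y j) = 0 := by linarith
  refine h6.trans (freq_mono fun y hy w hw hwy => ?_)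
  by_contra h0
  exact hy ⟨w, hw, h0, hwy⟩

/-- A function far from degree `d` is inconsistent with degree `d` on the images of determining
points under a random affine map with a noticeable frequency. -/
lemma le_freq_inconsistent_of_determining {d s : ℕ} {δ : ℝ} (hδ0 : 0 < δ) (hδ1 : δ ≤ 1)
    (hk : d + 1 ≤ Fintype.card κ) (hs : 2 ≤ s) (hs' : (Fintype.card κ + d).choose d + 1 ≤ s)
    {J : Type*} {y : J → κ → ZMod p}
    (hy : ∀ w ∈ polyDeg p κ (d + 1), (∀ j, w (y j) = 0) → w = 0)
    {f : (ι → ZMod p) → ZMod p} (hf : ∀ g ∈ polyDeg p ι d, δ ≤ freq fun x => f x ≠ g x) :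
    δ / (2 * s ^ 2) ≤ freq fun ω : (ι → ZMod p) × (κ → ι → ZMod p) =>
      ¬ ∃ w ∈ polyDeg p κ d, ∀ j, w (y j) = f (affinePt 0 ω.1 ω.2 (y j)) := by
  classical
  have hs0 : (2 : ℝ) ≤ s := by exact_mod_cast hs
  set Γ : Set ((κ → ZMod p) → ZMod p) := {μ | (Finset.univ.filter fun u => μ u ≠ 0).card ≤ s ∧
    (∀ u, μ u ≠ 0 → u ∈ Set.range y) ∧ ∀ w ∈ polyDeg p κ d, ∑ u, μ u * w u = 0} with hΓ
  have hchar : ∀ (g : (ι → ZMod p) → ZMod p),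
      (∀ ω, ¬ ViolatedAt Γ 0 g ω) → g ∈ polyDeg p ι d := by
    intro g hg
    refine mem_polyDeg_of_agrees hk hy fun x b => ?_
    refine exists_mem_eq_of_sparse_relations (polyDeg p κ d) y
      ((Nat.add_le_add_right (finrank_polyDeg_le d) 1).trans hs')
      (fun u => g (affinePt 0 x b u)) fun μ h1 h2 h3 => ?_
    by_contra hne
    exact hg (x, b) ⟨μ, ⟨h1, h2, h3⟩, hne⟩
  -- Recentring at `c` only moves the base point, a bijection on affine maps; self-correction needs
  -- a centre in the support of a constraint.
  have hshift : ∀ (c : κ → ZMod p) (x : ι → ZMod p) (b : κ → ι → ZMod p),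
      affinePt c x b = affinePt 0 (x - ∑ i, c i • b i) b := by
    intro c x b
    ext u j
    simp [affinePt, sub_smul, Finset.sum_sub_distrib]
    ring
  have hnot : f ∉ polyDeg p ι d := by
    intro hmem
    have := hf f hmem
    simp only [ne_eq, not_true_eq_false, freq_false] at this
    linarith
  -- As `f` is not of degree at most `d`, some constraint is violated; it is nonzero and supplies
  -- the centre `c`.
  obtain ⟨ω, μ, hμ, hne⟩ : ∃ ω, ViolatedAt Γ 0 f ω := by
    by_contra hcon
    push Not at hcon
    exact hnot (hchar f hcon)
  obtain ⟨c, -, hc⟩ := Finset.exists_ne_zero_of_sum_ne_zero hne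
  have hc : μ c ≠ 0 := left_ne_zero_of_mul hc
  have hle : freq (ViolatedAt Γ c f) ≤ freq fun ω : (ι → ZMod p) × (κ → ι → ZMod p) =>
      ¬ ∃ w ∈ polyDeg p κ d, ∀ j, w (y j) = f (affinePt 0 ω.1 ω.2 (y j)) := by
    rw [← freq_comp_surjective (fun ω : (ι → ZMod p) × (κ → ι → ZMod p) =>
      (ω.1 - ∑ i, c i • ω.2 i, ω.2)) ?_ ?_ (fun ω : (ι → ZMod p) × (κ → ι → ZMod p) =>
      ¬ ∃ w ∈ polyDeg p κ d, ∀ j, w (y j) = f (affinePt 0 ω.1 ω.2 (y j)))]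
    · refine freq_mono ?_
      rintro ⟨x, b⟩ ⟨ν, hν, hne⟩ ⟨w, hw, hwy⟩
      apply hne
      rw [← hν.2.2 w hw]
      refine Finset.sum_congr rfl fun u _ => ?_
      by_cases hu : ν u = 0
      · simp [hu]
      · obtain ⟨j, rfl⟩ := hν.2.1 u hu
        rw [hwy, hshift c]
    · intro ω ω'
      refine Prod.ext ?_ rfl
      simp only [Prod.fst_add, Prod.snd_add, Pi.add_apply, smul_add, Finset.sum_add_distrib]
      abel
    · rintro ⟨x, b⟩
      exact ⟨(x + ∑ i, c i • b i, b), by simp⟩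
  refine le_trans ?_ hle
  -- Either self-correction applies and gives `δ ≤ 2 η`, or `η ≥ 1 / (2 s²)`; both suffice.
  by_cases hη : 2 * (s : ℝ) ^ 2 * freq (ViolatedAt Γ c f) < 1
  · obtain ⟨g, hg, hfg⟩ := exists_close_of_freq_violatedAt hs (fun μ hμ => hμ.1) hμ hc hη
    have hgd : g ∈ polyDeg p ι d := by
      refine hchar g ?_
      rintro ⟨x, b⟩ ⟨ν, hν, hne⟩
      refine hg (x + ∑ i, c i • b i, b) ⟨ν, hν, ?_⟩
      rw [hshift c]
      simpa using hne
    have h1 := hf g hgd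
    rw [div_le_iff₀ (by positivity)]
    have h2 : 0 ≤ freq (ViolatedAt Γ c f) := freq_nonneg _
    have h3 : (4 : ℝ) ≤ s ^ 2 := by nlinarith
    have h4 := h1.trans hfg
    have h5 := mul_le_mul_of_nonneg_right h3 h2
    linarith
  · rw [div_le_iff₀ (by positivity)]
    linarith

/-- The lower bound for the probability that one round of the tester finds an inconsistency. -/
lemma le_freq_inconsistent {d s Q : ℕ} {δ : ℝ} (hδ0 : 0 < δ) (hδ1 : δ ≤ 1)
    (hk : d + 1 ≤ Fintype.card κ) (hs : 2 ≤ s) (hs' : (Fintype.card κ + d).choose d + 1 ≤ s)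
    (hQ : 2 ^ (d + 2) * (Fintype.card κ + (d + 1)).choose (d + 1) ≤ Q)
    {f : (ι → ZMod p) → ZMod p} (hf : ∀ g ∈ polyDeg p ι d, δ ≤ freq fun x => f x ≠ g x) :
    δ / (4 * s ^ 2) ≤ freq fun ω : (Fin Q → κ → ZMod p) × ((ι → ZMod p) × (κ → ι → ZMod p)) =>
      ¬ ∃ w ∈ polyDeg p κ d, ∀ j, w (ω.1 j) = f (affinePt 0 ω.2.1 ω.2.2 (ω.1 j)) := by
  have h1 := half_le_freq_determining (p := p) hQ
  have h2 := mul_freq_le_freq_prod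
    (P := fun (y : Fin Q → κ → ZMod p) (ω : (ι → ZMod p) × (κ → ι → ZMod p)) =>
      ¬ ∃ w ∈ polyDeg p κ d, ∀ j, w (y j) = f (affinePt 0 ω.1 ω.2 (y j)))
    (fun y hy => le_freq_inconsistent_of_determining hδ0 hδ1 hk hs hs' hy hf)
  refine le_trans ?_ h2
  have hs0 : (2 : ℝ) ≤ s := by exact_mod_cast hs
  calc δ / (4 * s ^ 2) = δ / (2 * s ^ 2) * (1 / 2) := by
        field_simp
        norm_num
    _ ≤ _ := by gcongr

end Round

/-! ### Nonadaptive algorithms against the adversary. -/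

section NonadaptiveTree

variable {X A : Type}

/-- The algorithm that queries the points of a list, whatever the answers, and decides according to
the transcript. -/
def nonadaptiveTree (dec : List (X × Option A) → Bool) :
    List X → List (X × Option A) → QueryTree X A
  | [], h => .output (dec h)
  | x :: xs, h => .query x fun a => nonadaptiveTree dec xs ((x, a) :: h)

lemma depth_nonadaptiveTree [Fintype A] (dec : List (X × Option A) → Bool) (xs : List X)
    (h : List (X × Option A)) : (nonadaptiveTree dec xs h).depth = xs.length := by
  induction xs generalizing h with
  | nil => rfl
  | cons x xs ih =>
    simp only [nonadaptiveTree, QueryTree.depth, ih, List.length_cons]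
    rw [Finset.sup_const Finset.univ_nonempty, add_comm]

variable [DecidableEq X] {t : ℕ}

/-- If every transcript without wrong answers is accepted, then so is the input. -/
lemma runFrom_nonadaptiveTree_eq_true {dec : List (X × Option A) → Bool} {f : X → A}
    (hdec : ∀ h : List (X × Option A), (∀ xa ∈ h, ∀ v, xa.2 = some v → f xa.1 = v) → dec h = true)
    (adv : ErasureAdversary X A t) (xs : List X) (h : List (X × Option A)) (E : Finset X)
    (hh : ∀ xa ∈ h, ∀ v, xa.2 = some v → f xa.1 = v) :
    (nonadaptiveTree dec xs h).runFrom f adv h E = true := by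
  induction xs generalizing h E with
  | nil => exact hdec h hh
  | cons x xs ih =>
    simp only [nonadaptiveTree, QueryTree.runFrom]
    refine ih _ _ fun xa hxa v hv => ?_
    rcases List.mem_cons.1 hxa with rfl | hxa
    · dsimp only at hv
      split_ifs at hv
      simpa using hv
    · exact hh xa hxa v hv

/-- The transcript, latest query first, when no answer is erased. -/
def transcript (f : X → A) (l : List X) : List (X × Option A) := l.map fun x => (x, some (f x))

/-- The entries erased after the given queries, latest first, when no answer is erased. -/
def erasedAfter (f : X → A) (adv : ErasureAdversary X A t) : List X → Finset X
  | [] => ∅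
  | x :: l => erasedAfter f adv l ∪ adv.erase (transcript f (x :: l))

lemma card_erasedAfter_le (f : X → A) (adv : ErasureAdversary X A t) (l : List X) :
    (erasedAfter f adv l).card ≤ t * l.length := by
  induction l with
  | nil => simp [erasedAfter]
  | cons x l ih =>
    rw [erasedAfter, List.length_cons, Nat.mul_succ]
    exact (Finset.card_union_le _ _).trans (Nat.add_le_add ih (adv.card_erase_le _))

/-- If no query hits an erased entry, then the decision is made on the true values. -/
lemma runFrom_nonadaptiveTree (dec : List (X × Option A) → Bool) (f : X → A)
    (adv : ErasureAdversary X A t) (xs l : List X)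
    (hx : ∀ (i : ℕ) (hi : i < xs.length),
      xs[i] ∉ erasedAfter f adv ((xs.take i).reverse ++ l)) :
    (nonadaptiveTree dec xs (transcript f l)).runFrom f adv (transcript f l)
      (erasedAfter f adv l) = dec (transcript f (xs.reverse ++ l)) := by
  induction xs generalizing l with
  | nil => rfl
  | cons x xs ih =>
    have h0 : x ∉ erasedAfter f adv l := by
      have h := hx 0 (by simp)
      simp only [List.take_zero, List.reverse_nil, List.nil_append] at h
      exact h
    have h1 := ih (x :: l) fun i hi => by
      have h := hx (i + 1) (by simpa using hi)
      simp only [List.take_succ_cons, List.reverse_cons, List.append_assoc,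
        List.singleton_append] at h
      exact h
    simp only [nonadaptiveTree, QueryTree.runFrom, if_neg h0]
    simpa [erasedAfter, transcript] using h1

end NonadaptiveTree

/-! ### Uniform coins. -/

section Uniform

/-- The values of a map at a uniformly random point. -/
lemma map_uniformOfFintype_apply {Ω β : Type*} [Fintype Ω] [Nonempty Ω] (g : Ω → β) (b : β) :
    PMF.map g (PMF.uniformOfFintype Ω) b = ENNReal.ofReal (freq fun ω => g ω = b) := by
  classical
  rw [PMF.map_apply, tsum_fintype, freq_eq_card_div,
    ENNReal.ofReal_div_of_pos (by exact_mod_cast Fintype.card_pos), ENNReal.ofReal_natCast,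
    ENNReal.ofReal_natCast]
  simp only [PMF.uniformOfFintype_apply, ← Finset.sum_filter, Finset.sum_const, nsmul_eq_mul]
  rw [div_eq_mul_inv]
  congr! 3
  ext ω
  simp [eq_comm]

end Uniform

/-! ### The probability of querying an erased entry. -/

section Hitting

variable {F V κ : Type*} [Field F] [AddCommGroup V] [Module F V] [Fintype κ] {Q R : ℕ}

/-- The coins of one round: points of `F^κ` and an affine map `F^κ → V`. -/
abbrev RoundCoins (F V κ : Type*) (Q : ℕ) : Type _ := (Fin Q → κ → F) × (V × (κ → V))

/-- The coins with the `j`-th point of round `r` replaced. -/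
def resample (r : Fin R) (j : Fin Q) (ω : Fin R → RoundCoins F V κ Q) (u : κ → F) :
    Fin R → RoundCoins F V κ Q :=
  Function.update ω r (Function.update (ω r).1 j u, (ω r).2)

/-- The `i`-th query of the tester. -/
def queryPoint (ω : Fin R → RoundCoins F V κ Q) (i : Fin (R * Q)) : V :=
  let rj := finProdFinEquiv.symm i
  affinePt 0 (ω rj.1).2.1 (ω rj.1).2.2 ((ω rj.1).1 rj.2)

lemma queryPoint_resample {i i' : Fin (R * Q)} (h : i' ≠ i) (ω : Fin R → RoundCoins F V κ Q)
    (u : κ → F) : queryPoint (resample (finProdFinEquiv.symm i).1 (finProdFinEquiv.symm i).2 ω u) i'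
      = queryPoint ω i' := by
  have hne : finProdFinEquiv.symm i' ≠ finProdFinEquiv.symm i := fun h' =>
    h (finProdFinEquiv.symm.injective h')
  simp only [queryPoint]
  set a := finProdFinEquiv.symm i'
  set b := finProdFinEquiv.symm i
  by_cases h1 : a.1 = b.1
  · have h2 : a.2 ≠ b.2 := fun h2 => hne (Prod.ext h1 h2)
    simp [resample, h1, h2]
  · simp [resample, h1]

variable [Fintype F] [DecidableEq κ]

/-- Each fibre of an affine map is empty or a coset of the kernel of its linear part. -/
lemma freq_affinePt_mem_le (E : Finset V) (x : V) (b : κ → V) :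
    freq (fun u : κ → F => affinePt 0 x b u ∈ E) ≤
      E.card * freq fun u : κ → F => ∑ i, u i • b i = 0 := by
  have h1 : freq (fun u : κ → F => affinePt 0 x b u ∈ E) ≤
      ∑ v ∈ E, freq fun u : κ → F => affinePt 0 x b u = v :=
    (freq_mono fun u hu => ⟨_, hu, rfl⟩).trans (freq_exists_le E _)
  refine h1.trans ((Finset.sum_le_sum fun v _ => ?_).trans_eq
    (by rw [Finset.sum_const, nsmul_eq_mul]))
  by_cases hv : ∃ u0 : κ → F, affinePt 0 x b u0 = v
  · obtain ⟨u0, rfl⟩ := hv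
    rw [← freq_add_left u0]
    refine freq_mono fun u hu => ?_
    simpa [affinePt, add_smul, Finset.sum_add_distrib] using hu
  · rw [← freq_add_left 0]
    exact freq_mono fun u hu => absurd ⟨_, hu⟩ hv

lemma freq_eq_const {G : Type*} [Fintype G] (v : G) :
    freq (fun g : G => g = v) = 1 / Fintype.card G := by
  classical
  rw [freq_eq_card_div]
  congr 1
  exact_mod_cast Finset.card_eq_one.2 ⟨v, by ext; simp⟩

variable [Fintype V]

/-- Either `u = 0`, or `∑ i, u i • b i` is uniform in `V`. -/
lemma freq_sum_smul_eq_zero_le :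
    freq (fun ω : (κ → F) × (κ → V) => ∑ i, ω.1 i • ω.2 i = 0) ≤
      1 / Fintype.card (κ → F) + 1 / Fintype.card V := by
  have h1 : freq (fun ω : (κ → F) × (κ → V) => ω.1 ≠ 0 ∧ ∑ i, ω.1 i • ω.2 i = 0) ≤
      1 / Fintype.card V := by
    refine freq_prod_le (P := fun (u : κ → F) (b : κ → V) => u ≠ 0 ∧ ∑ i, u i • b i = 0)
      (by positivity) fun u => ?_
    by_cases hu : u = 0
    · simp only [hu, ne_eq, not_true_eq_false, false_and, freq_false]
      positivity
    · rw [← freq_eq_const (0 : V), ← freq_comp_surjective (fun b : κ → V => ∑ i, u i • b i)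
        (fun a b => by simp [smul_add, Finset.sum_add_distrib])
        (fun y => exists_sum_smul_eq hu y) (fun y => y = 0)]
      exact freq_mono fun b hb => hb.2
  have h2 : freq (fun ω : (κ → F) × (κ → V) => ω.1 = 0) = 1 / Fintype.card (κ → F) := by
    rw [freq_fst fun u : κ → F => u = 0, freq_eq_const]
  refine (freq_mono (Q := fun ω : (κ → F) × (κ → V) =>
    ω.1 = 0 ∨ (ω.1 ≠ 0 ∧ ∑ i, ω.1 i • ω.2 i = 0)) fun ω hω => ?_).trans
    ((freq_or_le _ _).trans (add_le_add h2.le h1))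
  by_cases h : ω.1 = 0
  · exact Or.inl h
  · exact Or.inr ⟨h, hω⟩

/-- A random point of the image of a random affine map rarely lies in a small set that does not
depend on the choice of this point. -/
lemma freq_mem_le (r : Fin R) (j : Fin Q) (E : (Fin R → RoundCoins F V κ Q) → Finset V) {M : ℕ}
    (hM : ∀ ω, (E ω).card ≤ M) (hE : ∀ ω u, E (resample r j ω u) = E ω) :
    freq (fun ω : Fin R → RoundCoins F V κ Q =>
      affinePt 0 (ω r).2.1 (ω r).2.2 ((ω r).1 j) ∈ E ω) ≤
      M * (1 / Fintype.card (κ → F) + 1 / Fintype.card V) := by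
  -- Redrawing the `j`-th point preserves the uniform distribution and leaves `E` unchanged, so that
  -- point may be taken independent of `E`.
  have h1 : freq (fun ω : Fin R → RoundCoins F V κ Q =>
        affinePt 0 (ω r).2.1 (ω r).2.2 ((ω r).1 j) ∈ E ω) =
      freq fun ω : (Fin R → RoundCoins F V κ Q) × (κ → F) =>
        affinePt 0 (ω.1 r).2.1 (ω.1 r).2.2 ω.2 ∈ E ω.1 := by
    rw [← freq_comp_surjective (fun ω : (Fin R → RoundCoins F V κ Q) × (κ → F) =>
      resample r j ω.1 ω.2) ?_ ?_ (fun ω => affinePt 0 (ω r).2.1 (ω r).2.2 ((ω r).1 j) ∈ E ω)]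
    · simp only [hE]
      simp [resample]
    · rintro ⟨ω, u⟩ ⟨ω', u'⟩
      simp only [resample]
      rw [← Function.update_add]
      congr 1
      refine Prod.ext ?_ rfl
      exact Function.update_add _ _ _ _ _
    · intro ω
      exact ⟨(ω, (ω r).1 j), by simp [resample]⟩
  have h2 : freq (fun ω : (Fin R → RoundCoins F V κ Q) × (κ → F) =>
      ∑ i, ω.2 i • (ω.1 r).2.2 i = 0) ≤ 1 / Fintype.card (κ → F) + 1 / Fintype.card V := by
    refine le_of_eq_of_le ?_ (freq_sum_smul_eq_zero_le (F := F) (V := V) (κ := κ))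
    refine freq_comp_surjective (fun ω : (Fin R → RoundCoins F V κ Q) × (κ → F) =>
      ((ω.2, (ω.1 r).2.2) : (κ → F) × (κ → V))) (fun _ _ => rfl) ?_
      (fun ω : (κ → F) × (κ → V) => ∑ i, ω.1 i • ω.2 i = 0)
    rintro ⟨u, b⟩
    exact ⟨(fun _ => (0, 0, b), u), rfl⟩
  rw [h1]
  refine le_trans ?_ (mul_le_mul_of_nonneg_left h2 (Nat.cast_nonneg M))
  rw [freq_prod fun (ω : Fin R → RoundCoins F V κ Q) (u : κ → F) =>
      affinePt 0 (ω r).2.1 (ω r).2.2 u ∈ E ω,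
    freq_prod fun (ω : Fin R → RoundCoins F V κ Q) (u : κ → F) => ∑ i, u i • (ω r).2.2 i = 0,
    mul_div_assoc', Finset.mul_sum]
  refine div_le_div_of_nonneg_right (Finset.sum_le_sum fun ω _ => ?_) (Nat.cast_nonneg _)
  refine (freq_affinePt_mem_le _ _ _).trans ?_
  have := freq_nonneg fun u : κ → F => ∑ i, u i • (ω r).2.2 i = 0
  have h3 : ((E ω).card : ℝ) ≤ M := by exact_mod_cast hM ω
  gcongr

/-- Union bound over `R * Q` queries, each facing at most `t * (R * Q)` erased entries. Those
entries are fixed by the earlier queries, hence unaffected by redrawing the current point. -/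
lemma freq_hit_le {A : Type} {V κ : Type} [AddCommGroup V] [Module F V] [Fintype κ]
    [DecidableEq κ] [Fintype V] [DecidableEq V] {t : ℕ} (f : V → A)
    (adv : ErasureAdversary V A t) :
    freq (fun ω : Fin R → RoundCoins F V κ Q => ∃ i : Fin (R * Q), queryPoint ω i ∈
      erasedAfter f adv ((List.ofFn (queryPoint ω)).take i).reverse) ≤
      t * (R * Q : ℝ) ^ 2 * (1 / Fintype.card (κ → F) + 1 / Fintype.card V) := by
  have h1 : ∀ i ∈ (Finset.univ : Finset (Fin (R * Q))),
      freq (fun ω : Fin R → RoundCoins F V κ Q => queryPoint ω i ∈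
        erasedAfter f adv ((List.ofFn (queryPoint ω)).take i).reverse) ≤
      (t * (R * Q) : ℕ) * (1 / Fintype.card (κ → F) + 1 / Fintype.card V) := by
    intro i _
    refine freq_mem_le (finProdFinEquiv.symm i).1 (finProdFinEquiv.symm i).2
      (fun ω => erasedAfter f adv ((List.ofFn (queryPoint ω)).take i).reverse) ?_ ?_
    · intro ω
      refine (card_erasedAfter_le _ _ _).trans (Nat.mul_le_mul_left _ ?_)
      simp
    · intro ω u
      congr 2
      refine List.ext_getElem (by simp) fun l h1 h2 => ?_
      simp only [List.getElem_take, List.getElem_ofFn]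
      refine queryPoint_resample ?_ ω u
      intro h
      have : l < i := by
        rw [List.length_take] at h1
        exact lt_of_lt_of_le h1 (min_le_left _ _)
      rw [Fin.ext_iff] at h
      exact this.ne h
  have h2 := (freq_exists_le Finset.univ _).trans (Finset.sum_le_sum h1)
  simp only [Finset.mem_univ, true_and] at h2
  refine h2.trans_eq ?_
  rw [Finset.sum_const, nsmul_eq_mul]
  simp only [Finset.card_univ, Fintype.card_fin]
  push_cast
  ring

end Hitting

/-! ### The tester and its analysis. -/

section Tester

variable {p : ℕ} [Fact p.Prime]

open Classical in
/-- The algorithm that queries the points given by the coins and rejects if no function of degree at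
most `d` agrees with all answers that are not erased. -/
noncomputable def degreeTree (d : ℕ) {n k R Q : ℕ}
    (ω : Fin R → RoundCoins (ZMod p) (Fin n → ZMod p) (Fin k) Q) :
    QueryTree (Fin n → ZMod p) (ZMod p) :=
  nonadaptiveTree (fun h => decide (∃ g ∈ reedMuller n p d, ∀ xa ∈ h, ∀ v, xa.2 = some v →
    g xa.1 = v)) (List.ofFn (queryPoint ω)) []

/-- The tester for degree at most `d`: in each of `R` rounds it queries `Q` random points of the
image of a random affine map from `𝔽_p^k`. -/
noncomputable def degreeTester (p n d k R Q : ℕ) [Fact p.Prime] :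
    RandomizedTester (Fin n → ZMod p) (ZMod p) :=
  (PMF.uniformOfFintype (Fin R → RoundCoins (ZMod p) (Fin n → ZMod p) (Fin k) Q)).map
    (degreeTree d)

lemma makesAtMostQueries_degreeTester (n d k R Q : ℕ) :
    MakesAtMostQueries (degreeTester p n d k R Q) (R * Q) := by
  intro T hT
  rw [degreeTester, PMF.support_map] at hT
  obtain ⟨ω, -, rfl⟩ := hT
  rw [degreeTree, depth_nonadaptiveTree, List.length_ofFn]
  push_cast
  exact le_rfl

lemma prob_degreeTester {n d k R Q t : ℕ} (f : (Fin n → ZMod p) → ZMod p)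
    (adv : ErasureAdversary (Fin n → ZMod p) (ZMod p) t) (b : Bool) :
    (degreeTester p n d k R Q).prob f adv b =
      ENNReal.ofReal (freq fun ω : Fin R → RoundCoins (ZMod p) (Fin n → ZMod p) (Fin k) Q =>
        (degreeTree d ω).run f adv = b) := by
  rw [RandomizedTester.prob, degreeTester, PMF.map_comp]
  exact map_uniformOfFintype_apply _ b

lemma run_degreeTree_of_mem {n d k R Q t : ℕ} {f : (Fin n → ZMod p) → ZMod p}
    (hf : f ∈ reedMuller n p d) (adv : ErasureAdversary (Fin n → ZMod p) (ZMod p) t)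
    (ω : Fin R → RoundCoins (ZMod p) (Fin n → ZMod p) (Fin k) Q) :
    (degreeTree d ω).run f adv = true := by
  classical
  exact runFrom_nonadaptiveTree_eq_true (fun _ hh => decide_eq_true ⟨f, hf, hh⟩) adv _ _ _ (by simp)

/-- The erased sets are those of the hypothetical run with every answer given; if no query meets
them, the actual run coincides with it. -/
lemma hit_or_agrees_of_run_degreeTree {n d k R Q t : ℕ} {f : (Fin n → ZMod p) → ZMod p}
    {adv : ErasureAdversary (Fin n → ZMod p) (ZMod p) t}
    {ω : Fin R → RoundCoins (ZMod p) (Fin n → ZMod p) (Fin k) Q}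
    (hω : (degreeTree d ω).run f adv = true) :
    (∃ i : Fin (R * Q), queryPoint ω i ∈
      erasedAfter f adv ((List.ofFn (queryPoint ω)).take i).reverse) ∨
    ∃ g ∈ reedMuller n p d, ∀ i : Fin (R * Q), g (queryPoint ω i) = f (queryPoint ω i) := by
  classical
  refine or_iff_not_imp_left.2 fun h1 => ?_
  have h3 := (runFrom_nonadaptiveTree _ f adv (List.ofFn (queryPoint ω)) [] (fun i hi => by
    rw [List.length_ofFn] at hi
    simpa using fun h => h1 ⟨⟨i, hi⟩, h⟩)).symm.trans hω
  rw [decide_eq_true_iff] at h3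
  obtain ⟨g, hg, hgf⟩ := h3
  refine ⟨g, hg, fun i => hgf (queryPoint ω i, some (f (queryPoint ω i))) ?_ _ rfl⟩
  simpa [transcript] using ⟨i, rfl, rfl⟩

lemma le_freq_ne_of_le_distToDegree {n d : ℕ} {δ : ℝ} {f : (Fin n → ZMod p) → ZMod p}
    (hf : δ ≤ distToDegree d f) : ∀ g ∈ polyDeg p (Fin n) d, δ ≤ freq fun x => f x ≠ g x := by
  intro g hg
  refine hf.trans ((ciInf_le ⟨0, ?_⟩ (⟨g, mem_reedMuller_iff.2 hg⟩ : reedMuller n p d)).trans_eq ?_)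
  · rintro _ ⟨g, rfl⟩
    exact div_nonneg (Nat.cast_nonneg _) (Nat.cast_nonneg _)
  · rw [freq_eq_card_div]
    rfl

/-- The tester is online-erasure-resilient if it has enough rounds and if it queries a small part of
the image of an affine map. -/
theorem isOnlineErasureResilientTester_degreeTester {n d k R Q s t : ℕ} {δ : ℝ} (hδ0 : 0 < δ)
    (hδ1 : δ ≤ 1) (hk : d + 1 ≤ k) (hs : 2 ≤ s) (hs' : (k + d).choose d + 1 ≤ s)
    (hQ : 2 ^ (d + 2) * (k + (d + 1)).choose (d + 1) ≤ Q) (hR : 8 * (s : ℝ) ^ 2 / δ ≤ R)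
    (hhit : t * (R * Q : ℝ) ^ 2 * (1 / (p : ℝ) ^ k + 1 / (p : ℝ) ^ n) ≤ 1 / 6) :
    IsOnlineErasureResilientTester t d δ (degreeTester p n d k R Q) := by
  intro f adv
  constructor
  · intro hf
    rw [prob_degreeTester]
    simp only [run_degreeTree_of_mem hf, freq_true, ENNReal.ofReal_one]
  · intro hf
    have hfar := le_freq_ne_of_le_distToDegree hf
    rw [prob_degreeTester]
    set good : RoundCoins (ZMod p) (Fin n → ZMod p) (Fin k) Q → Prop := fun ω =>
      ∃ w ∈ polyDeg p (Fin k) d, ∀ j, w (ω.1 j) = f (affinePt 0 ω.2.1 ω.2.2 (ω.1 j)) with hgood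
    have h1 : δ / (4 * s ^ 2) ≤ freq fun ω => ¬ good ω :=
      le_freq_inconsistent hδ0 hδ1 (by simpa using hk) hs (by simpa using hs')
        (by simpa using hQ) hfar
    rw [freq_not] at h1
    have hs0 : (2 : ℝ) ≤ s := by exact_mod_cast hs
    -- The rounds are independent, so all are consistent with probability at most `exp (-2) ≤ 1 /
    -- 6`; hits contribute the other `1 / 6`.
    have h2 : freq (fun ω : Fin R → RoundCoins (ZMod p) (Fin n → ZMod p) (Fin k) Q =>
        ∀ r, good (ω r)) ≤ 1 / 6 := by
      rw [freq_pi_forall]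
      have h3 : freq good ≤ Real.exp (-(δ / (4 * s ^ 2))) := by
        have := Real.add_one_le_exp (-(δ / (4 * s ^ 2)))
        linarith
      have h4 : (2 : ℝ) ≤ R * (δ / (4 * s ^ 2)) := by
        calc (2 : ℝ) = 8 * (s : ℝ) ^ 2 / δ * (δ / (4 * s ^ 2)) := by
              field_simp
              norm_num
          _ ≤ _ := by gcongr
      have h5 : (6 : ℝ) ≤ Real.exp 2 := by
        have h6 := Real.exp_one_gt_d9
        rw [show (2 : ℝ) = 1 + 1 by norm_num, Real.exp_add]
        nlinarith
      calc freq good ^ R ≤ Real.exp (-(δ / (4 * s ^ 2))) ^ R :=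
            pow_le_pow_left₀ (freq_nonneg _) h3 R
        _ = Real.exp (-(R * (δ / (4 * s ^ 2)))) := by
            rw [← Real.exp_nat_mul, mul_neg]
        _ ≤ Real.exp (-2) := Real.exp_le_exp.2 (by linarith)
        _ ≤ 1 / 6 := by
            rw [Real.exp_neg, ← one_div]
            exact one_div_le_one_div_of_le (by norm_num) h5
    have h3 := freq_hit_le (F := ZMod p) (κ := Fin k) (Q := Q) (R := R) f adv
    simp only [Fintype.card_pi, ZMod.card, Finset.prod_const, Finset.card_univ,
      Fintype.card_fin, Nat.cast_pow] at h3
    have h4 : freq (fun ω : Fin R → RoundCoins (ZMod p) (Fin n → ZMod p) (Fin k) Q =>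
        ¬ (degreeTree d ω).run f adv = false) ≤ 1 / 3 := by
      refine (freq_mono (Q := fun ω => (∃ i : Fin (R * Q), queryPoint ω i ∈
        erasedAfter f adv ((List.ofFn (queryPoint ω)).take i).reverse) ∨ ∀ r, good (ω r))
        fun ω hω => ?_).trans ((freq_or_le _ _).trans ?_)
      · refine (hit_or_agrees_of_run_degreeTree (by simpa using hω)).imp_right ?_
        rintro ⟨g, hg, hgf⟩ r
        -- The function that fits all answers pulls back to a witness for every round.
        refine ⟨g ∘ affinePt 0 (ω r).2.1 (ω r).2.2,
          comp_mem_polyDeg (isAffineMap_affinePt _ _ _) (mem_reedMuller_iff.1 hg), fun j => ?_⟩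
        simpa [queryPoint] using hgf (finProdFinEquiv (r, j))
      · linarith
    rw [freq_not] at h4
    rw [show (2 / 3 : ENNReal) = ENNReal.ofReal (2 / 3) by
      rw [ENNReal.ofReal_div_of_pos (by norm_num)]
      norm_num]
    exact ENNReal.ofReal_le_ofReal (by linarith)

end Tester

/-! ### Numerical estimates. -/

section Numerics

lemma choose_add_le_pow (k m : ℕ) : (k + m).choose m ≤ (k + 1) ^ m := by
  induction m with
  | zero => simp
  | succ m ih =>
    have h1 := Nat.add_one_mul_choose_eq (k + m) m
    refine Nat.le_of_mul_le_mul_right (c := m + 1) ?_ (Nat.succ_pos m)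
    rw [← add_assoc, ← h1, pow_succ]
    calc (k + m + 1) * (k + m).choose m ≤ ((k + 1) * (m + 1)) * (k + 1) ^ m :=
          Nat.mul_le_mul (by nlinarith) ih
      _ = (k + 1) ^ m * (k + 1) * (m + 1) := by ring

/-- Pascal's rule with `1 / 64 + 63 / 64 = 1`. The growth in `k` has a base so near one that it is
negligible against `2 ^ k`, uniformly in `d`. -/
lemma choose_add_le_mul_pow (k m : ℕ) :
    ((k + m).choose m : ℝ) ≤ 64 ^ m * (64 / 63) ^ k := by
  induction k generalizing m with
  | zero =>
    simp only [zero_add, Nat.choose_self, Nat.cast_one, pow_zero, mul_one]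
    exact one_le_pow₀ (by norm_num)
  | succ k ihk =>
    induction m with
    | zero =>
      simp only [Nat.choose_zero_right, Nat.cast_one, pow_zero, one_mul]
      exact one_le_pow₀ (by norm_num)
    | succ m ihm =>
      have h1 : (k + 1 + (m + 1)).choose (m + 1) =
          (k + 1 + m).choose m + (k + (m + 1)).choose (m + 1) := by
        rw [show k + 1 + (m + 1) = (k + 1 + m) + 1 by ring, Nat.choose_succ_succ,
          show k + 1 + m = k + (m + 1) by ring]
      rw [h1]
      push_cast
      refine (add_le_add ihm (ihk (m + 1))).trans_eq ?_
      rw [pow_succ _ k, pow_succ _ m]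
      ring

/-- The squared number of queries is small compared with the number of points of `𝔽_2^k`. -/
lemma mul_pow_le_of_two_pow_le {d k : ℕ} (hd : 1 ≤ d) {z s Q : ℝ} (hz : 30 ≤ z)
    (hk : (2 : ℝ) ^ k ≤ 2 * z ^ (20 * d)) (hs0 : 0 ≤ s) (hQ0 : 0 ≤ Q)
    (hs : s ≤ 2 * (64 ^ d * (64 / 63) ^ k))
    (hQ : Q ≤ 2 ^ (d + 2) * (64 ^ (d + 1) * (64 / 63) ^ k)) :
    2 * z ^ 2 * (s ^ 4 * Q ^ 2) ≤ z ^ (20 * d) := by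
  set B : ℝ := (64 / 63) ^ k with hB
  have hB1 : 1 ≤ B := one_le_pow₀ (by norm_num)
  -- This uses `(64 / 63) ^ 40 ≤ 2`.
  have hB40 : B ^ 40 ≤ 2 * z ^ (20 * d) := by
    refine le_trans ?_ hk
    rw [hB, ← pow_mul, mul_comm, pow_mul]
    exact pow_le_pow_left₀ (by positivity) (by norm_num) k
  have hz0 : 0 < z := by linarith
  have h64 : ∀ m : ℕ, (64 : ℝ) ^ m = 2 ^ (6 * m) := fun m => by
    rw [pow_mul]
    norm_num
  have h1 : 2 * z ^ 2 * (s ^ 4 * Q ^ 2) ≤ 2 ^ (38 * d + 21) * z ^ 2 * B ^ 8 := by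
    calc 2 * z ^ 2 * (s ^ 4 * Q ^ 2)
        ≤ 2 * z ^ 2 * ((2 * (64 ^ d * B)) ^ 4 * (2 ^ (d + 2) * (64 ^ (d + 1) * B)) ^ 2) := by
          gcongr
      _ = 2 ^ (38 * d + 21) * z ^ 2 * B ^ 6 := by
          rw [h64, h64]
          ring
      _ ≤ 2 ^ (38 * d + 21) * z ^ 2 * B ^ 8 := by
          gcongr
          norm_num
  -- Fifth powers turn `B ^ 8` into `B ^ 40`; this was the reason for rounding the exponent 6 up to
  -- 8.
  refine h1.trans (le_of_pow_le_pow_left₀ (n := 5) (by norm_num) (by positivity) ?_)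
  have hz10 : (2 : ℝ) ^ 49 ≤ z ^ 10 := by
    refine le_trans ?_ (pow_le_pow_left₀ (by norm_num) hz 10)
    norm_num
  have h2 : (2 : ℝ) ^ (190 * d + 106) * z ^ 10 ≤ z ^ (80 * d) := by
    have h3 : (2 : ℝ) ^ (190 * d + 106) ≤ (2 ^ 49) ^ (7 * d) := by
      rw [← pow_mul]
      exact pow_le_pow_right₀ (by norm_num) (by omega)
    calc (2 : ℝ) ^ (190 * d + 106) * z ^ 10 ≤ (2 ^ 49) ^ (7 * d) * z ^ 10 := by gcongr
      _ ≤ (z ^ 10) ^ (7 * d) * z ^ 10 := by gcongr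
      _ = z ^ (10 * (7 * d) + 10) := by rw [← pow_mul, ← pow_add]
      _ ≤ z ^ (80 * d) := pow_le_pow_right₀ (by linarith) (by omega)
  calc (2 ^ (38 * d + 21) * z ^ 2 * B ^ 8) ^ 5
      = 2 ^ (190 * d + 105) * z ^ 10 * B ^ 40 := by ring
    _ ≤ 2 ^ (190 * d + 105) * z ^ 10 * (2 * z ^ (20 * d)) := by gcongr
    _ = 2 ^ (190 * d + 106) * z ^ 10 * z ^ (20 * d) := by ring
    _ ≤ z ^ (80 * d) * z ^ (20 * d) := by gcongr
    _ = (z ^ (20 * d)) ^ 5 := by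
        rw [← pow_add, ← pow_mul]
        congr 1
        ring

/-- With `u = 2 t / δ ≥ 2` one has `30 t / δ = 15 u ≤ u ^ 5`, and the rounding terms are absorbed
because `log u ≥ log 2`. -/
lemma add_one_le_mul_log {d : ℕ} {t : ℕ} {δ : ℝ} (ht : 1 ≤ t) (hδ0 : 0 < δ) (hδ1 : δ ≤ 1) :
    (⌈20 * d * Real.logb 2 (30 * t / δ)⌉₊ + 1 : ℝ) ≤
      (100 * d + 2) / Real.log 2 * Real.log (2 * t / δ) := by
  have hl2 : 0 < Real.log 2 := Real.log_pos (by norm_num)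
  have ht' : (1 : ℝ) ≤ t := by exact_mod_cast ht
  have hu : 2 ≤ 2 * t / δ := by
    rw [le_div_iff₀ hδ0]
    nlinarith
  set u := 2 * t / δ with hudef
  have hL : Real.log 2 ≤ Real.log u := Real.log_le_log (by norm_num) hu
  have hz : Real.log (30 * t / δ) ≤ 5 * Real.log u := by
    rw [show 30 * t / δ = 15 * u by rw [hudef]; ring,
      Real.log_mul (by norm_num) (by positivity)]
    have : Real.log 15 ≤ 4 * Real.log 2 := by
      rw [show (4 : ℝ) * Real.log 2 = Real.log (2 ^ 4) by rw [Real.log_pow]; norm_num]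
      exact Real.log_le_log (by norm_num) (by norm_num)
    linarith
  have hz0 : 0 ≤ Real.logb 2 (30 * t / δ) := by
    refine Real.logb_nonneg (by norm_num) ?_
    rw [le_div_iff₀ hδ0]
    nlinarith
  have h1 := (Nat.ceil_lt_add_one (show 0 ≤ 20 * d * Real.logb 2 (30 * t / δ) by positivity)).le
  have h2 : Real.logb 2 (30 * t / δ) ≤ 5 * Real.log u / Real.log 2 := by
    rw [Real.logb]
    gcongr
  have h3 : 1 ≤ Real.log u / Real.log 2 := (one_le_div hl2).2 hL
  calc (⌈20 * d * Real.logb 2 (30 * t / δ)⌉₊ + 1 : ℝ)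
      ≤ 20 * d * (5 * Real.log u / Real.log 2) + 2 * (Real.log u / Real.log 2) := by
        have : 20 * d * Real.logb 2 (30 * t / δ) ≤ 20 * d * (5 * Real.log u / Real.log 2) := by
          gcongr
        linarith
    _ = (100 * d + 2) / Real.log 2 * Real.log u := by ring

lemma two_pow_ceil_bounds {d : ℕ} {z : ℝ} (hz : 30 ≤ z) :
    z ^ (20 * d) ≤ 2 ^ ⌈20 * d * Real.logb 2 z⌉₊ ∧
      (2 : ℝ) ^ ⌈20 * d * Real.logb 2 z⌉₊ ≤ 2 * z ^ (20 * d) := by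
  have hz0 : 0 < z := by linarith
  have h0 : 0 ≤ Real.logb 2 z := Real.logb_nonneg (by norm_num) (by linarith)
  have hX : (2 : ℝ) ^ (20 * d * Real.logb 2 z) = z ^ (20 * d) := by
    rw [mul_comm, Real.rpow_mul (by norm_num), Real.rpow_logb (by norm_num) (by norm_num) hz0,
      ← Real.rpow_natCast]
    push_cast
    rfl
  rw [← hX, ← Real.rpow_natCast]
  constructor
  · exact Real.rpow_le_rpow_of_exponent_le (by norm_num) (Nat.le_ceil _)
  · calc (2 : ℝ) ^ ((⌈20 * d * Real.logb 2 z⌉₊ : ℕ) : ℝ)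
        ≤ 2 ^ (20 * d * Real.logb 2 z + 1) :=
          Real.rpow_le_rpow_of_exponent_le (by norm_num)
            (Nat.ceil_lt_add_one (by positivity)).le
      _ = 2 * 2 ^ (20 * d * Real.logb 2 z) := by
          rw [Real.rpow_add (by norm_num), Real.rpow_one, mul_comm]

end Numerics

/-! ### Choice of parameters. -/

theorem theorem1 (d : ℕ) (hd : 1 ≤ d) :
    ∃ C : ℝ, 0 < C ∧
      ∀ (p : ℕ) [Fact p.Prime] (n t : ℕ) (δ : ℝ), 1 ≤ t → 0 < δ → δ ≤ 1 →
        (t : ℝ) ≤ δ / 30 * (p : ℝ) ^ ((n : ℝ) / (20 * (d : ℝ))) →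
        ∃ R : RandomizedTester (Fin n → ZMod p) (ZMod p),
          IsOnlineErasureResilientTester t d δ R ∧
          MakesAtMostQueries R (C * (Real.log (2 * (t : ℝ) / δ) ^ (3 * d + 3) / δ)) := by
  have hl2 : 0 < Real.log 2 := Real.log_pos (by norm_num)
  set K : ℝ := (100 * d + 2) / Real.log 2 with hK
  have hK0 : 0 < K := by positivity
  refine ⟨36 * 2 ^ (d + 2) * K ^ (3 * d + 3), by positivity, ?_⟩
  intro p hp n t δ ht hδ0 hδ1 hsmall
  have ht' : (1 : ℝ) ≤ t := by exact_mod_cast ht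
  have hp2 : (2 : ℝ) ≤ p := by exact_mod_cast hp.out.two_le
  set z : ℝ := 30 * t / δ with hz
  have hz30 : 30 ≤ z := by
    rw [hz, le_div_iff₀ hδ0]
    nlinarith
  have hz0 : 0 < z := by linarith
  set k : ℕ := ⌈20 * d * Real.logb 2 z⌉₊ with hk
  obtain ⟨hkX, hkX2⟩ := two_pow_ceil_bounds (d := d) hz30
  set X : ℝ := z ^ (20 * d) with hX
  have hX0 : 0 < X := by positivity
  have hdk : d + 1 ≤ k := by
    have h1 : (2 : ℝ) ^ (20 * d) ≤ 2 ^ k :=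
      (pow_le_pow_left₀ (by norm_num) (by linarith) _).trans hkX
    have h2 := (pow_le_pow_iff_right₀ (by norm_num : (1 : ℝ) < 2)).1 h1
    omega
  have hpk : X ≤ (p : ℝ) ^ k := hkX.trans (pow_le_pow_left₀ (by norm_num) hp2 k)
  -- This is the assumed bound on `t`, raised to the power `20 d`.
  have hpn : X ≤ (p : ℝ) ^ n := by
    have h1 : z ≤ (p : ℝ) ^ ((n : ℝ) / (20 * (d : ℝ))) := by
      rw [hz, div_le_iff₀ hδ0]
      linarith
    have hd0 : (d : ℝ) ≠ 0 := by
      have : (1 : ℝ) ≤ d := by exact_mod_cast hd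
      linarith
    calc X ≤ ((p : ℝ) ^ ((n : ℝ) / (20 * (d : ℝ)))) ^ (20 * d) :=
          pow_le_pow_left₀ hz0.le h1 _
      _ = (p : ℝ) ^ n := by
          rw [← Real.rpow_natCast, ← Real.rpow_mul (by linarith), ← Real.rpow_natCast]
          congr 1
          push_cast
          field_simp
  set s : ℕ := (k + d).choose d + 1 with hs
  set Q : ℕ := 2 ^ (d + 2) * (k + (d + 1)).choose (d + 1) with hQ
  set R : ℕ := ⌈8 * (s : ℝ) ^ 2 / δ⌉₊ with hR
  have hs2 : 2 ≤ s := by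
    have := Nat.choose_pos (Nat.le_add_left d k)
    omega
  have hs2' : (2 : ℝ) ≤ s := by exact_mod_cast hs2
  have hRle : (R : ℝ) ≤ 9 * s ^ 2 / δ := by
    have h1 := (Nat.ceil_lt_add_one (show 0 ≤ 8 * (s : ℝ) ^ 2 / δ by positivity)).le
    have h2 : 1 ≤ (s : ℝ) ^ 2 / δ := by
      rw [le_div_iff₀ hδ0]
      nlinarith
    calc (R : ℝ) ≤ 8 * (s : ℝ) ^ 2 / δ + 1 := h1
      _ ≤ 8 * (s : ℝ) ^ 2 / δ + s ^ 2 / δ := by gcongr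
      _ = 9 * s ^ 2 / δ := by ring
  refine ⟨degreeTester p n d k R Q, ?_, ?_⟩
  · refine isOnlineErasureResilientTester_degreeTester hδ0 hδ1 hdk hs2 le_rfl le_rfl
      (Nat.le_ceil _) ?_
    have hmain : 2 * z ^ 2 * ((s : ℝ) ^ 4 * (Q : ℝ) ^ 2) ≤ X := by
      refine mul_pow_le_of_two_pow_le hd hz30 hkX2 (Nat.cast_nonneg _) (Nat.cast_nonneg _) ?_ ?_
      · have h1 := choose_add_le_mul_pow k d
        have h2 : (1 : ℝ) ≤ 64 ^ d * (64 / 63) ^ k := one_le_mul_of_one_le_of_one_le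
          (one_le_pow₀ (by norm_num)) (one_le_pow₀ (by norm_num))
        rw [hs]
        push_cast
        linarith
      · rw [hQ]
        push_cast
        gcongr
        exact choose_add_le_mul_pow k (d + 1)
    have hsum : 1 / (p : ℝ) ^ k + 1 / (p : ℝ) ^ n ≤ 2 / X := by
      have h1 := one_div_le_one_div_of_le hX0 hpk
      have h2 := one_div_le_one_div_of_le hX0 hpn
      calc _ ≤ 1 / X + 1 / X := add_le_add h1 h2
        _ = 2 / X := by ring
    -- The factor `9 / 100` is `9² / 30²`, from `R ≤ 9 s² / δ` and `z = 30 t / δ`.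
    calc (t : ℝ) * (R * Q) ^ 2 * (1 / (p : ℝ) ^ k + 1 / (p : ℝ) ^ n)
        ≤ t ^ 2 * (9 * s ^ 2 / δ * Q) ^ 2 * (2 / X) := by
          have : (t : ℝ) ≤ t ^ 2 := by nlinarith
          gcongr
      _ = 9 / 100 * (2 * z ^ 2 * (s ^ 4 * Q ^ 2)) / X := by
          rw [hz]
          field_simp
          ring
      _ ≤ 9 / 100 * X / X := by gcongr
      _ = 9 / 100 := by field_simp
      _ ≤ 1 / 6 := by norm_num
  · intro T hT
    refine (makesAtMostQueries_degreeTester n d k R Q T hT).trans ?_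
    have hkL : (k + 1 : ℝ) ≤ K * Real.log (2 * t / δ) := add_one_le_mul_log ht hδ0 hδ1
    have hk1 : (1 : ℝ) ≤ k + 1 := by
      have : (0 : ℝ) ≤ k := Nat.cast_nonneg k
      linarith
    have hsk : (s : ℝ) ≤ 2 * (k + 1) ^ d := by
      have h1 : ((k + d).choose d : ℝ) ≤ (k + 1) ^ d := by exact_mod_cast choose_add_le_pow k d
      have h2 : (1 : ℝ) ≤ (k + 1) ^ d := one_le_pow₀ hk1
      rw [hs]
      push_cast
      linarith
    have hQk : (Q : ℝ) ≤ 2 ^ (d + 2) * (k + 1) ^ (d + 1) := by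
      rw [hQ]
      exact_mod_cast Nat.mul_le_mul_left _ (choose_add_le_pow k (d + 1))
    calc (R * Q : ℝ) ≤ 9 * (2 * (k + 1) ^ d) ^ 2 / δ * (2 ^ (d + 2) * (k + 1) ^ (d + 1)) := by
          refine mul_le_mul (hRle.trans ?_) hQk (Nat.cast_nonneg _) (by positivity)
          gcongr
      _ = 36 * 2 ^ (d + 2) * (k + 1) ^ (3 * d + 1) / δ := by ring
      -- The parameters yield the exponent `3 d + 1`; the stated one has slack.
      _ ≤ 36 * 2 ^ (d + 2) * (k + 1) ^ (3 * d + 3) / δ := by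
          gcongr
          norm_num
      _ ≤ 36 * 2 ^ (d + 2) * (K * Real.log (2 * t / δ)) ^ (3 * d + 3) / δ := by gcongr
      _ = 36 * 2 ^ (d + 2) * K ^ (3 * d + 3) * (Real.log (2 * t / δ) ^ (3 * d + 3) / δ) := by
          rw [mul_pow]
          ring
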